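/- **Setting.** A $k$-pair quantum network consists of a finite set of nodes, a finite set of edges between nodes, $k$ distinct input nodes and $k$ distinct output nodes. Each edge is a one-qubit quantum channel and classical communication between all nodes is free; accordingly each edge is replaced by one EPR pair $|\Phi^+\rangle=(|00\rangle+|11\rangle)/\sqrt2$ shared by its two ends, and $|\Phi\rangle_{\mathcal R}$ denotes the tensor product of these pairs over all edges. The $i$-th input qubit is at the $i$-th input node and the $i$-th output qubit at the $i$-th output node. A $k$-qubit unitary $U$ is *deterministically implementable* over the network if there is a (finite-round, multipartite) LOCC map $\Gamma$ between the nodes, from the input and resource qubits to the output qubits, with $$\Gamma\bigl(|\psi\rangle\langle\psi|\otimes|\Phi\rangle\langle\Phi|_{\mathcal R}\bigr)=U|\psi\rangle\langle\psi|U^\dagger\quad\text{for every pure } k\text{-qubit state } |\psi\rangle .$$ The butterfly network has nodes $i_1,i_2,o_1,o_2,n_1,n_2$ and edges $i_1o_1,\ i_1n_1,\ i_2o_2,\ i_2n_1,\ n_1n_2,\ n_2o_1,\ n_2o_2$. The grail network has nodes $i_1,i_2,o_1,o_2,n_1,n_2,n_3,n_4$ and edges $i_1n_1,\ i_2n_1,\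 i_2n_3,\ n_1n_2,\ n_2n_3,\ n_2o_1,\ n_3n_4,\ n_4o_1,\ n_4o_2$. In both, $i_1,i_2$ are the input nodes and $o_1,o_2$ the output nodes. The $(k,N)$-cluster network is the $k\times N$ grid with nodes $v_{i,j}$ ($1\le i\le k$, $1\le j\le N$), with edges joining horizontal and vertical nearest neighbours. **Theorem.** 1. Every two-qubit unitary is deterministically implementable over the butterfly network. 2. The assignment $i_1,n_1,i_2,o_1,n_2,o_2\mapsto v_{1,1},v_{2,1},v_{3,1},v_{1,2},v_{2,2},v_{3,2}$ is an isomorphism of (undirected) graphs from the butterfly network onto the $(3,2)$-cluster network. 3. For $x,y,z\in\mathbb R$ let $U_{global}(x,y,z)=e^{i(xX\otimes X+yY\otimes Y+zZ\otimes Z)}$. For one-qubit operators $u^{(ab)}$ let $C_{1,3;2}(\{u^{(ab)}\})=\sum_{a,b\in\{0,1\}}|ab\rangle\langle ab|_{13}\otimes u^{(ab)}_2$. Let $H$ be the Hadamard gate and $u(x)=H\bigl(e^{ix}|0\rangle\langle0|-ie^{-ix}|1\rangle\langle1|\bigr)$. Let $u^{(00)}=u^{(11)}=\mathbb I$, $u^{(01)}=u^{(10)}=Z$,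 and $$w^{(00)}=w^{(11)}=e^{i(z-y)}|0\rangle\langle0|-ie^{i(z+y)}|1\rangle\langle1|,\qquad w^{(01)}=w^{(10)}=e^{-i(z-y)}|0\rangle\langle0|-ie^{-i(z+y)}|1\rangle\langle1| .$$ Put $$U_3=u(x)_2\;C_{1,3;2}(\{w^{(ab)}\})\;X_1X_3\;H_1H_2H_3\;C_{1,3;2}(\{u^{(ab)}\})\;H_1H_2H_3 ,$$ and let $\Gamma_0$ be the map that measures qubit $2$ in the computational basis and, if and only if the outcome is $1$, applies $X$ to each of the qubits $1$ and $3$. Then for every operator $\rho$ on the qubits $1,3$, $$\Gamma_0\bigl(U_3(\rho_{13}\otimes|0\rangle\langle0|_2)U_3^\dagger\bigr)=U_{global}(x,y,z)\,\rho\,U_{global}(x,y,z)^\dagger .$$ 4. Every two-qubit unitary is deterministically implementable over the grail network. -/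

import Mathlib

open scoped Matrix

noncomputable section

namespace QNet

/-! ### Multipartite LOCC

Every party `v` holds a finite-dimensional system with orthonormal basis indexed by `ι v`; the joint
system has basis `∀ v, ι v`. -/

/-- The tensor product `⨂ v, A v` of local operators. -/
def tensorOp {V : Type} [Fintype V] {ι κ : V → Type} (A : ∀ v, Matrix (κ v) (ι v) ℂ) :
    Matrix (∀ v, κ v) (∀ v, ι v) ℂ :=
  Matrix.of fun x y => ∏ v, A v (x v) (y v)

/-- `IsLOCC Γ`: the map `Γ` on operators is realised by a finite protocol of local operations and
classical communication between the parties `v : V`.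

In one round a party `p` applies a quantum instrument to its system, with Kraus operators `A o p`
(`o` ranging over the finite set of outcomes), the outcome `o` is announced to all parties, and
every other party `v` applies an isometry `A o v` that may depend on `o`. The rest of the protocol,
`next o`, may depend on `o`, hence on all the outcomes so far; at the end all the outcomes are
forgotten. The local systems may change from round to round, so that ancillas can be added and
subsystems discarded. A local operation with several Kraus operators for one outcome, and in
particular any local channel, is a round whose continuation ignores part of `o`. -/
inductive IsLOCC {V : Type} [Fintype V] [DecidableEq V] : ∀ {ι κ : V → Type},
    (Matrix (∀ v, ι v) (∀ v, ι v) ℂ → Matrix (∀ v, κ v) (∀ v, κ v) ℂ) → Prop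
  | done {ι : V → Type} : IsLOCC (fun ρ : Matrix (∀ v, ι v) (∀ v, ι v) ℂ => ρ)
  | round {ι μ κ : V → Type} [∀ v, Fintype (ι v)] [∀ v, DecidableEq (ι v)] [∀ v, Fintype (μ v)]
      {O : Type} [Fintype O] (p : V) (A : O → ∀ v, Matrix (μ v) (ι v) ℂ)
      (instrument : ∑ o, (A o p)ᴴ * A o p = 1)
      (isometries : ∀ o v, v ≠ p → (A o v)ᴴ * A o v = 1)
      (next : O → Matrix (∀ v, μ v) (∀ v, μ v) ℂ → Matrix (∀ v, κ v) (∀ v, κ v) ℂ)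
      (isLOCC_next : ∀ o, IsLOCC (next o)) :
      IsLOCC fun ρ : Matrix (∀ v, ι v) (∀ v, ι v) ℂ =>
        ∑ o, next o (tensorOp (A o) * ρ * (tensorOp (A o))ᴴ)

/-! ### Quantum networks and implementability -/

/-- A `k`-pair network on the nodes `V`: edges (each a one-qubit channel), `k` distinct input nodes
and `k` distinct output nodes. -/
structure Network (V : Type) (k : ℕ) where
  edges : Finset (V × V)
  input : Fin k ↪ V
  output : Fin k ↪ V

/-- The qubits of the family `Q` that lie at node `v`, when qubit `q` is at node `loc q`. -/
abbrev QubitsAt {V Q : Type} (loc : Q → V) (v : V) : Type := {q : Q // loc q = v}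

/-- Basis labels, node by node, of the qubits of a family `Q` placed at the nodes by `loc`. -/
abbrev NodeBits {V Q : Type} (loc : Q → V) (v : V) : Type := QubitsAt loc v → Fin 2

/-- Forget the grouping by nodes: from a basis label of the joint system of all nodes to the
corresponding assignment of bits to qubits (a bijection). -/
def ungroup {V Q : Type} (loc : Q → V) (x : ∀ v, NodeBits loc v) : Q → Fin 2 :=
  fun q => x (loc q) ⟨q, rfl⟩

/-- The projector `|ψ⟩⟨ψ|`. -/
def proj {n : Type} (ψ : n → ℂ) : Matrix n n ℂ := Matrix.vecMulVec ψ (star ψ)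

namespace Network

variable {V : Type} {k : ℕ} (G : Network V k)

/-- The qubits at the start: `k` input qubits and, for each edge, the two qubits of an EPR pair. -/
abbrev Qubit : Type := Fin k ⊕ (G.edges × Fin 2)

/-- Where the initial qubits are: input qubit `i` at the `i`-th input node, and the two qubits of
the EPR pair of an edge at the two ends of the edge. -/
def loc : G.Qubit → V
  | .inl i => G.input i
  | .inr (e, b) => if b = 0 then e.1.1 else e.1.2

/-- The state `|ψ⟩ ⊗ |Φ⟩`, where `|Φ⟩` is the resource state, the tensor product over all
edges of the EPR states `(|00⟩ + |11⟩) / √2`. -/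
def initialState (ψ : (Fin k → Fin 2) → ℂ) : (G.Qubit → Fin 2) → ℂ := fun x =>
  ψ (fun i => x (.inl i)) *
    ∏ e : G.edges, if x (.inr (e, 0)) = x (.inr (e, 1)) then ((1 / √2 : ℝ) : ℂ) else 0

/-- The `k`-qubit operator `U` is deterministically implementable over the network: some LOCC map
between the nodes, from the input qubits and the EPR pairs to output qubits (the `i`-th one at the
`i`-th output node), takes `|ψ⟩⟨ψ| ⊗ |Φ⟩⟨Φ|` to `U |ψ⟩⟨ψ| U†` for every pure state `ψ`. -/
def Implements [Fintype V] [DecidableEq V]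
    (U : Matrix (Fin k → Fin 2) (Fin k → Fin 2) ℂ) : Prop :=
  ∃ Γ : Matrix (∀ v, NodeBits G.loc v) (∀ v, NodeBits G.loc v) ℂ →
      Matrix (∀ v, NodeBits G.output v) (∀ v, NodeBits G.output v) ℂ,
    IsLOCC Γ ∧ ∀ ψ : (Fin k → Fin 2) → ℂ, ∑ x, ‖ψ x‖ ^ 2 = 1 →
      Γ ((proj (G.initialState ψ)).submatrix (ungroup G.loc) (ungroup G.loc)) =
        (U * proj ψ * Uᴴ).submatrix (ungroup G.output) (ungroup G.output)

end Network

/-! ### The butterfly, grail and cluster networks -/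

inductive ButterflyNode
  | i₁ | i₂ | o₁ | o₂ | n₁ | n₂
  deriving DecidableEq

open ButterflyNode in
instance : Fintype ButterflyNode := ⟨{i₁, i₂, o₁, o₂, n₁, n₂}, fun v => by cases v <;> decide⟩

open ButterflyNode in
/-- The butterfly network. -/
def butterfly : Network ButterflyNode 2 where
  edges := {(i₁, o₁), (i₁, n₁), (i₂, o₂), (i₂, n₁), (n₁, n₂), (n₂, o₁), (n₂, o₂)}
  input := ⟨![i₁, i₂], by decide⟩
  output := ⟨![o₁, o₂], by decide⟩

inductive GrailNode
  | i₁ | i₂ | o₁ | o₂ | n₁ | n₂ | n₃ | n₄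
  deriving DecidableEq

open GrailNode in
instance : Fintype GrailNode :=
  ⟨{i₁, i₂, o₁, o₂, n₁, n₂, n₃, n₄}, fun v => by cases v <;> decide⟩

open GrailNode in
/-- The grail network. -/
def grail : Network GrailNode 2 where
  edges := {(i₁, n₁), (n₄, o₂), (i₂, n₁), (n₁, n₂), (n₂, n₃), (i₂, n₃), (n₂, o₁), (n₃, n₄), (n₄, o₁)}
  input := ⟨![i₁, i₂], by decide⟩
  output := ⟨![o₁, o₂], by decide⟩

/-- The `(k, N)`-cluster network, with nodes `(i, j)` for `i < k` and `j < N` (numbered from `0`). -/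
def cluster (k N : ℕ) [NeZero N] : Network (Fin k × Fin N) k where
  edges := Finset.univ.filter fun e =>
    (e.1.1.val + 1 = e.2.1.val ∧ e.1.2 = e.2.2) ∨ (e.1.1 = e.2.1 ∧ e.1.2.val + 1 = e.2.2.val)
  input := ⟨fun i => (i, 0), fun _ _ h => (Prod.ext_iff.mp h).1⟩
  output := ⟨fun i => (i, ⟨N - 1, Nat.sub_one_lt (NeZero.ne N)⟩), fun _ _ h => (Prod.ext_iff.mp h).1⟩

/-- There is an edge between `u` and `v`, in one direction or the other. -/
def Network.Adj {V : Type} {k : ℕ} (G : Network V k) (u v : V) : Prop :=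
  (u, v) ∈ G.edges ∨ (v, u) ∈ G.edges

/-! ### Gates -/

def pauliX : Matrix (Fin 2) (Fin 2) ℂ := !![0, 1; 1, 0]
def pauliY : Matrix (Fin 2) (Fin 2) ℂ := !![0, -Complex.I; Complex.I, 0]
def pauliZ : Matrix (Fin 2) (Fin 2) ℂ := !![1, 0; 0, -1]

/-- The Hadamard gate. -/
def hadamard : Matrix (Fin 2) (Fin 2) ℂ := ((1 / √2 : ℝ) : ℂ) • !![1, 1; 1, -1]

/-- The one-qubit operator `A` applied to qubit `q` of `n` qubits. -/
def onQubit {n : ℕ} (q : Fin n) (A : Matrix (Fin 2) (Fin 2) ℂ) :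
    Matrix (Fin n → Fin 2) (Fin n → Fin 2) ℂ :=
  Matrix.of fun x y => if ∀ j, j ≠ q → x j = y j then A (x q) (y q) else 0

/-- The fully controlled three-qubit operator `∑ a b, |ab⟩⟨ab| ⊗ u a b`, with the first and third
qubits as controls and the second qubit as target. -/
def fullyControlled (u : Fin 2 → Fin 2 → Matrix (Fin 2) (Fin 2) ℂ) :
    Matrix (Fin 3 → Fin 2) (Fin 3 → Fin 2) ℂ :=
  Matrix.of fun x y => if x 0 = y 0 ∧ x 2 = y 2 then u (x 0) (x 2) (x 1) (y 1) else 0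

/-- `exp (i (x X⊗X + y Y⊗Y + z Z⊗Z))`. -/
def uGlobal (x y z : ℝ) : Matrix (Fin 2 → Fin 2) (Fin 2 → Fin 2) ℂ :=
  NormedSpace.exp (Complex.I •
    ((x : ℂ) • (onQubit 0 pauliX * onQubit 1 pauliX) + (y : ℂ) • (onQubit 0 pauliY * onQubit 1 pauliY)
      + (z : ℂ) • (onQubit 0 pauliZ * onQubit 1 pauliZ)))

/-! ### The circuit -/

/-- Targets of the first fully controlled gate. -/
def firstTarget (a b : Fin 2) : Matrix (Fin 2) (Fin 2) ℂ := if a = b then 1 else pauliZ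

/-- Targets of the second fully controlled gate. -/
def secondTarget (y z : ℝ) (a b : Fin 2) : Matrix (Fin 2) (Fin 2) ℂ :=
  if a = b then
    !![Complex.exp (Complex.I * (z - y)), 0; 0, -Complex.I * Complex.exp (Complex.I * (z + y))]
  else
    !![Complex.exp (-Complex.I * (z - y)), 0; 0, -Complex.I * Complex.exp (-Complex.I * (z + y))]

/-- The last gate on the second qubit, `H (e^{ix} |0⟩⟨0| - i e^{-ix} |1⟩⟨1|)`. -/
def lastGate (x : ℝ) : Matrix (Fin 2) (Fin 2) ℂ :=
  hadamard * !![Complex.exp (Complex.I * x), 0; 0, -Complex.I * Complex.exp (-Complex.I * x)]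

/-- The unitary part of the circuit (the rightmost factor acts first). -/
def circuit (x y z : ℝ) : Matrix (Fin 3 → Fin 2) (Fin 3 → Fin 2) ℂ :=
  onQubit 1 (lastGate x) * fullyControlled (secondTarget y z)
    * (onQubit 0 pauliX * onQubit 2 pauliX)
    * (onQubit 0 hadamard * onQubit 1 hadamard * onQubit 2 hadamard)
    * fullyControlled firstTarget
    * (onQubit 0 hadamard * onQubit 1 hadamard * onQubit 2 hadamard)

/-- `⟨m|` on the second of three qubits; the first and third qubits remain. -/
def braSecond (m : Fin 2) : Matrix (Fin 2 → Fin 2) (Fin 3 → Fin 2) ℂ :=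
  Matrix.of fun a x => if x 0 = a 0 ∧ x 1 = m ∧ x 2 = a 1 then 1 else 0

/-- `ρ ⊗ |0⟩⟨0|`, with `ρ` on the first and third qubits and `|0⟩` on the second. -/
def prepareZero (ρ : Matrix (Fin 2 → Fin 2) (Fin 2 → Fin 2) ℂ) :
    Matrix (Fin 3 → Fin 2) (Fin 3 → Fin 2) ℂ := (braSecond 0)ᴴ * ρ * braSecond 0

/-- The operator for outcome `m` when the second qubit is measured in the computational basis and,
if `m = 1`, the correction `X` is applied to both remaining qubits. -/
def outcomeOp (m : Fin 2) : Matrix (Fin 2 → Fin 2) (Fin 3 → Fin 2) ℂ :=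
  (if m = 1 then onQubit 0 pauliX * onQubit 1 pauliX else 1) * braSecond m

/-- The measurement of the second qubit followed by the correction. -/
def measureAndCorrect (σ : Matrix (Fin 3 → Fin 2) (Fin 3 → Fin 2) ℂ) :
    Matrix (Fin 2 → Fin 2) (Fin 2 → Fin 2) ℂ :=
  ∑ m, outcomeOp m * σ * (outcomeOp m)ᴴ

end QNet

end

namespace QNet

/-! ### Properties of LOCC maps -/

section LOCC

variable {V : Type} [Fintype V] [DecidableEq V]

/-! Both implementability claims reduce to one family of gates. By `exists_cartan_decomposition` a
two-qubit unitary is, up to a scalar, `uGlobal x y z` between one-qubit unitaries, and one-qubit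
unitaries are local. `Network.implements_of_cartan` performs this reduction.

Protocols are followed on amplitudes of pure states. `Reaches` asks for the target only up to a
scalar that does not depend on the input, so norms and outcome probabilities can be ignored; trace
preservation gives the scalar 1 at the end (`Network.implements_of_reaches`). An EPR pair copies a
bit in the computational basis to its far end (`QubitReaches.copy`), and an X measurement with a
phase correction erases a copy (`QubitReaches.uncopy`). Erasing the original after copying is
teleportation; using the copy and then erasing it gives a phase that depends on a distant bit.

Butterfly: X⊗X and Z⊗Z commute and Y⊗Y = -(X⊗X)(Z⊗Z), so `uGlobal` multiplies by a phase depending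
on two parities. The X⊗X parity is written into an ancilla at n₁, which moves to n₂ and receives
there a phase controlled by the bits at o₁ and o₂. Measuring the ancilla in a rotated basis leaves a
byproduct (X⊗X)^m, undone after announcing m. The computation is `outcome_amplitude`, which serves
both the explicit circuit and the protocol.

Grail: the paths i₁n₁n₂o₁ and i₂n₃n₄o₂ carry the two qubits, and each of the three remaining edges
supplies one of the commuting factors exp(ixX⊗X), exp(iyY⊗Y), exp(izZ⊗Z).

Cartan decomposition: in the magic basis two-qubit vectors are quaternions, on which A⊗B acts by M ↦
A M Bᵀ. Hence real orthogonal matrices are local up to one fixed reflection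
(`isLocalUpToReflection_of_orthogonal`). Diagonalising WᵀW by a real orthogonal matrix writes a
unitary W as orthogonal · diagonal · orthogonal, and since the magic basis diagonalises X⊗X, Y⊗Y and
Z⊗Z, the diagonal factor is some `uGlobal` up to a scalar. -/

theorem tensorOp_mul {ι μ κ : V → Type} [∀ v, Fintype (μ v)] (A : ∀ v, Matrix (κ v) (μ v) ℂ)
    (B : ∀ v, Matrix (μ v) (ι v) ℂ) :
    tensorOp A * tensorOp B = tensorOp fun v => A v * B v := by
  ext x y
  simp only [tensorOp, Matrix.mul_apply, Matrix.of_apply, ← Finset.prod_mul_distrib]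
  rw [Finset.prod_univ_sum, Fintype.piFinset_univ]

omit [DecidableEq V] in
theorem conjTranspose_tensorOp {ι κ : V → Type} (A : ∀ v, Matrix (κ v) (ι v) ℂ) :
    (tensorOp A)ᴴ = tensorOp fun v => (A v)ᴴ := by
  ext x y
  simp [tensorOp, Matrix.conjTranspose_apply]

omit [DecidableEq V] in
theorem tensorOp_one {ι : V → Type} [∀ v, DecidableEq (ι v)] :
    tensorOp (fun v => (1 : Matrix (ι v) (ι v) ℂ)) = 1 := by
  ext x y
  simp [tensorOp, Matrix.one_apply, funext_iff, Finset.prod_ite_zero]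

theorem sum_tensorOp_update {ι κ : V → Type} {O : Type} [Fintype O] (p : V)
    (A : ∀ v, Matrix (κ v) (ι v) ℂ) (B : O → Matrix (κ p) (ι p) ℂ) :
    ∑ o, tensorOp (Function.update A p (B o)) = tensorOp (Function.update A p (∑ o, B o)) := by
  ext x y
  simp only [tensorOp, Matrix.sum_apply, Matrix.of_apply]
  rw [← Finset.mul_prod_erase _ _ (Finset.mem_univ p), Function.update_self, Matrix.sum_apply,
    Finset.sum_mul]
  refine Finset.sum_congr rfl fun o _ => ?_
  rw [← Finset.mul_prod_erase _ _ (Finset.mem_univ p), Function.update_self]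
  congr 1
  refine Finset.prod_congr rfl fun v hv => ?_
  rw [Function.update_of_ne (Finset.ne_of_mem_erase hv),
    Function.update_of_ne (Finset.ne_of_mem_erase hv)]

theorem IsLOCC.map_smul {ι κ : V → Type}
    {Γ : Matrix (∀ v, ι v) (∀ v, ι v) ℂ → Matrix (∀ v, κ v) (∀ v, κ v) ℂ} (h : IsLOCC Γ) (c : ℂ) :
    ∀ ρ, Γ (c • ρ) = c • Γ ρ := by
  induction h with
  | done => intro ρ; rfl
  | round p A hA hA' next hnext ih =>
    intro ρ
    simp only [Matrix.mul_smul, Matrix.smul_mul, ih, Finset.smul_sum]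

/-- The isometries contribute identity factors for every outcome, so the sum over outcomes takes
place in the factor of `p` alone. -/
theorem sum_conjTranspose_tensorOp_mul {ι μ : V → Type} [∀ v, Fintype (μ v)]
    [∀ v, DecidableEq (ι v)] {O : Type} [Fintype O] (p : V) (A : O → ∀ v, Matrix (μ v) (ι v) ℂ)
    (instrument : ∑ o, (A o p)ᴴ * A o p = 1)
    (isometries : ∀ o v, v ≠ p → (A o v)ᴴ * A o v = 1) :
    ∑ o, (tensorOp (A o))ᴴ * tensorOp (A o) = 1 := by
  have h : ∀ o, (tensorOp (A o))ᴴ * tensorOp (A o) =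
      tensorOp (Function.update (fun v => (1 : Matrix (ι v) (ι v) ℂ)) p ((A o p)ᴴ * A o p)) := by
    intro o
    rw [conjTranspose_tensorOp, tensorOp_mul]
    congr 1
    funext v
    by_cases hv : v = p
    · subst hv; rw [Function.update_self]
    · rw [Function.update_of_ne hv, isometries o v hv]
  simp only [h]
  rw [sum_tensorOp_update, instrument, Function.update_eq_self, tensorOp_one]

/-- The joint Kraus operators of a round are complete, so each round preserves the trace. The
`Fintype` instances are bound after `h` because the type families vary along the induction and
`done` carries no instances. -/
theorem IsLOCC.trace_eq {ι κ : V → Type}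
    {Γ : Matrix (∀ v, ι v) (∀ v, ι v) ℂ → Matrix (∀ v, κ v) (∀ v, κ v) ℂ} (h : IsLOCC Γ) :
    ∀ [Fintype (∀ v, ι v)] [Fintype (∀ v, κ v)] (ρ : Matrix (∀ v, ι v) (∀ v, ι v) ℂ),
      (Γ ρ).trace = ρ.trace := by
  induction h with
  | done =>
    intro _ _ ρ
    congr!
  | @round ι μ κ _ _ _ O _ p A hA hA' next hnext ih =>
    intro i₁ i₂ ρ
    have hi : i₁ = Pi.instFintype := Subsingleton.elim _ _
    subst hi
    rw [Matrix.trace_sum]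
    simp only [ih]
    have : ∀ o, (tensorOp (A o) * ρ * (tensorOp (A o))ᴴ).trace =
        (((tensorOp (A o))ᴴ * tensorOp (A o)) * ρ).trace := by
      intro o
      rw [Matrix.trace_mul_comm, Matrix.mul_assoc]
    simp only [this]
    rw [← Matrix.trace_sum, ← Finset.sum_mul, sum_conjTranspose_tensorOp_mul p A hA hA',
      Matrix.one_mul]

end LOCC

/-! ### Reachability of families of pure states -/

theorem proj_smul {n : Type} (c : ℂ) (ψ : n → ℂ) : proj (c • ψ) = (c * star c) • proj ψ := by
  ext i j
  simp [proj, Matrix.vecMulVec_apply]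
  ring

theorem mul_proj_mul {m n : Type} [Fintype n] (A : Matrix m n ℂ) (ψ : n → ℂ) :
    A * proj ψ * Aᴴ = proj (A *ᵥ ψ) := by
  rw [proj, proj, Matrix.mul_vecMulVec, Matrix.vecMulVec_mul, Matrix.star_mulVec]

theorem ungroup_bijective {V Q : Type} (loc : Q → V) : Function.Bijective (ungroup loc) := by
  refine ⟨fun x y h => ?_, fun x => ⟨fun v q => x q.1, rfl⟩⟩
  funext v ⟨q, hq⟩
  subst hq
  exact congrFun h q

section Reaches

variable {V : Type} [Fintype V] [DecidableEq V] {κ : V → Type} {Ψ : Type}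

/-- Some LOCC map takes each of the states `φ ψ` to `χ ψ`, up to a factor independent of `ψ`. -/
def Reaches {ι : V → Type} (φ : Ψ → (∀ v, ι v) → ℂ) (χ : Ψ → (∀ v, κ v) → ℂ) : Prop :=
  ∃ Γ : Matrix (∀ v, ι v) (∀ v, ι v) ℂ → Matrix (∀ v, κ v) (∀ v, κ v) ℂ,
    IsLOCC Γ ∧ ∃ r : ℂ, ∀ ψ, Γ (proj (φ ψ)) = r • proj (χ ψ)

theorem Reaches.refl (χ : Ψ → (∀ v, κ v) → ℂ) : Reaches χ χ :=
  ⟨_, .done, 1, fun ψ => (one_smul ℂ (proj (χ ψ))).symm⟩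

theorem Reaches.smul {ι : V → Type} {φ : Ψ → (∀ v, ι v) → ℂ} {χ : Ψ → (∀ v, κ v) → ℂ}
    (h : Reaches φ χ) (c : ℂ) : Reaches (fun ψ => c • φ ψ) χ := by
  obtain ⟨Γ, hΓ, r, hr⟩ := h
  refine ⟨Γ, hΓ, c * star c * r, fun ψ => ?_⟩
  rw [proj_smul, hΓ.map_smul, hr, smul_smul]

/-- Branches may have different factors: all their final states are multiples of the same projector,
so forgetting the outcome adds the factors. -/
theorem Reaches.round {ι μ : V → Type} [∀ v, Fintype (ι v)] [∀ v, DecidableEq (ι v)]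
    [∀ v, Fintype (μ v)] {φ : Ψ → (∀ v, ι v) → ℂ} {χ : Ψ → (∀ v, κ v) → ℂ}
    {O : Type} [Fintype O] (p : V) (A : O → ∀ v, Matrix (μ v) (ι v) ℂ)
    (instrument : ∑ o, (A o p)ᴴ * A o p = 1)
    (isometries : ∀ o v, v ≠ p → (A o v)ᴴ * A o v = 1)
    (h : ∀ o, Reaches (fun ψ => tensorOp (A o) *ᵥ φ ψ) χ) : Reaches φ χ := by
  choose Γ hΓ r hr using h
  refine ⟨_, .round p A instrument isometries Γ hΓ, ∑ o, r o, fun ψ => ?_⟩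
  simp only [mul_proj_mul, hr, Finset.sum_smul]

end Reaches

/-! ### Discarding -/

section Discard

variable {V : Type} {Ψ : Type} {ι κ : V → Type}

/-- The system of a party before (`false`) and after (`true`) it has discarded its waste. -/
abbrev Stage (ι κ : V → Type) (v : V) : Bool → Type
  | false => ι v
  | true => κ v

instance [∀ v, Fintype (ι v)] [∀ v, Fintype (κ v)] (v : V) : ∀ b, Fintype (Stage ι κ v b)
  | false => inferInstanceAs (Fintype (ι v))
  | true => inferInstanceAs (Fintype (κ v))

instance [∀ v, DecidableEq (ι v)] [∀ v, DecidableEq (κ v)] (v : V) :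
    ∀ b, DecidableEq (Stage ι κ v b)
  | false => inferInstanceAs (DecidableEq (ι v))
  | true => inferInstanceAs (DecidableEq (κ v))

/-- What is kept. -/
def Stage.get {J : V → Type} (E : ∀ v, ι v ≃ κ v × J v) (v : V) : ∀ b, Stage ι κ v b → κ v
  | false, w => (E v w).1
  | true, w => w

/-- The label before a step that leads to a given label, when `j` is discarded. -/
def Stage.before {J : V → Type} (E : ∀ v, ι v ≃ κ v × J v) (v : V) (j : J v) :
    ∀ b b', Stage ι κ v b' → Stage ι κ v b
  | false, true, w => (E v).symm (w, j)
  | false, false, w => w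
  | true, true, w => w
  | true, false, w => (E v w).1

theorem Stage.get_before {J : V → Type} (E : ∀ v, ι v ≃ κ v × J v) (v : V) (j : J v) (b b' : Bool)
    (w : Stage ι κ v b') : Stage.get E v b (Stage.before E v j b b' w) = Stage.get E v b' w := by
  cases b <;> cases b' <;> simp [Stage.get, Stage.before]

theorem Stage.before_self {J : V → Type} (E : ∀ v, ι v ≃ κ v × J v) (v : V) (j : J v) (b : Bool)
    (w : Stage ι κ v b) : Stage.before E v j b b w = w := by
  cases b <;> rfl

/-- The amplitudes do not depend on the discarded labels, so measuring these labels yields the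
target for every outcome. Only one party measures in a round; hence the parties take turns, and
`Stage` records who has finished. -/
theorem Reaches.discard [Fintype V] [DecidableEq V] [∀ v, Fintype (ι v)] [∀ v, DecidableEq (ι v)] [∀ v, Fintype (κ v)]
    [∀ v, DecidableEq (κ v)] {J : V → Type} [∀ v, Fintype (J v)] [∀ v, DecidableEq (J v)]
    [∀ v, Nonempty (J v)]
    (E : ∀ v, ι v ≃ κ v × J v) (χ : Ψ → (∀ v, κ v) → ℂ) :
    Reaches (fun ψ (x : ∀ v, ι v) => χ ψ fun v => (E v (x v)).1) χ := by
  -- `S` is the set of parties that still hold waste. Its indicator `s` stays a variable, so that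
  -- the induction can change the types of the systems.
  suffices H : ∀ (S : Finset V) (s : V → Bool), (∀ v, s v = false ↔ v ∈ S) →
      Reaches (fun ψ (x : ∀ v, Stage ι κ v (s v)) => χ ψ fun v => Stage.get E v (s v) (x v)) χ from
    H Finset.univ (fun _ => false) (by simp)
  intro S
  induction S using Finset.induction_on with
  | empty =>
    intro s hs
    obtain rfl : s = fun _ => true := by
      funext v
      simpa using hs v
    exact Reaches.refl χ
  | insert p S hp ih =>
    intro s hs
    let j₀ : ∀ v, J v := fun v => Classical.arbitrary _
    let s' : V → Bool := Function.update s p true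
    have hs'p : s' p = true := Function.update_self ..
    have hs' : ∀ v, v ≠ p → s' v = s v := fun v hv => Function.update_of_ne hv ..
    have hsp : s p = false := (hs p).2 (by simp)
    have hS : ∀ v, s' v = false ↔ v ∈ S := by
      intro v
      by_cases hv : v = p
      · subst hv; simp [hs'p, hp]
      · rw [hs' v hv, hs v, Finset.mem_insert]; simp [hv]
    refine Reaches.round (μ := fun v => Stage ι κ v (s' v)) (O := J p) p
      (fun j v => Matrix.of fun x y =>
        if y = Stage.before E v (Function.update j₀ p j v) (s v) (s' v) x then 1 else 0) ?_ ?_ ?_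
    · simp only [Function.update_self]
      -- The types depend on `s p` and `s' p`; once these are variables, substitution turns the two
      -- stages into `ι p` and `κ p`.
      generalize hb : s p = b at *
      generalize hb' : s' p = b' at *
      subst hsp hs'p
      ext w w'
      simp only [Matrix.sum_apply, Matrix.mul_apply, Matrix.conjTranspose_apply, Matrix.of_apply,
        Stage.before, Matrix.one_apply]
      refine Eq.trans (Finset.sum_comm.trans (Fintype.sum_prod_type' (fun u j =>
        star (if w = (E p).symm (u, j) then (1 : ℂ) else 0) *
          (if w' = (E p).symm (u, j) then 1 else 0))).symm) ?_
      rw [← (E p).sum_comp]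
      simp
    · intro j v hv
      ext w w'
      have h := hs' v hv
      simp only [Function.update_of_ne hv]
      generalize s' v = b' at *
      subst h
      simp only [Matrix.mul_apply, Matrix.conjTranspose_apply, Matrix.of_apply, Stage.before_self,
        Matrix.one_apply]
      simp
    · intro j
      convert ih s' hS using 2 with ψ
      funext x
      simp only [Matrix.mulVec, dotProduct, tensorOp, Matrix.of_apply]
      rw [Finset.sum_eq_single (fun v => Stage.before E v (Function.update j₀ p j v) (s v) (s' v) (x v))]
      · simp [Stage.get_before]
      · intro y _ hy
        obtain ⟨v, hv⟩ := Function.ne_iff.1 hy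
        rw [Finset.prod_eq_zero (Finset.mem_univ v), zero_mul]
        rw [if_neg hv]
      · simp

end Discard

/-! ### Local operations on qubits -/

section Qubits

variable {V Q : Type} [Fintype Q] [DecidableEq Q] {loc : Q → V}

/-- The one-qubit operator `A` applied to qubit `q` of a family. -/
def atQubit (q : Q) (A : Matrix (Fin 2) (Fin 2) ℂ) : Matrix (Q → Fin 2) (Q → Fin 2) ℂ :=
  Matrix.of fun x y => if ∀ j, j ≠ q → x j = y j then A (x q) (y q) else 0

theorem atQubit_mulVec (q : Q) (A : Matrix (Fin 2) (Fin 2) ℂ) (φ : (Q → Fin 2) → ℂ)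
    (x : Q → Fin 2) :
    (atQubit q A *ᵥ φ) x = ∑ b, A (x q) b * φ (Function.update x q b) := by
  simp only [Matrix.mulVec, dotProduct, atQubit, Matrix.of_apply]
  have h : Function.Injective fun b => Function.update x q b := Function.update_injective x q
  rw [← Finset.sum_subset (Finset.subset_univ (Finset.univ.map ⟨_, h⟩))]
  · rw [Finset.sum_map]
    refine Finset.sum_congr rfl fun b _ => ?_
    rw [Function.Embedding.coeFn_mk, if_pos, Function.update_self]
    intro j hj
    rw [Function.update_of_ne hj]
  · intro y _ hy
    rw [if_neg, zero_mul]
    intro hxy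
    refine hy (Finset.mem_map.2 ⟨y q, Finset.mem_univ _, ?_⟩)
    funext j
    by_cases hj : j = q
    · subst hj; simp
    · simp [hj, hxy j hj]

theorem atQubit_mul (q : Q) (A B : Matrix (Fin 2) (Fin 2) ℂ) :
    atQubit q A * atQubit q B = atQubit q (A * B) := by
  refine Matrix.ext_of_mulVec_single fun y => ?_
  rw [← Matrix.mulVec_mulVec]
  generalize (Pi.single y 1 : (Q → Fin 2) → ℂ) = φ
  funext x
  simp [atQubit_mulVec, Matrix.mul_apply, Fin.sum_univ_two]
  ring

theorem conjTranspose_atQubit (q : Q) (A : Matrix (Fin 2) (Fin 2) ℂ) :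
    (atQubit q A)ᴴ = atQubit q Aᴴ := by
  ext x y
  simp only [atQubit, Matrix.conjTranspose_apply, Matrix.of_apply, @eq_comm _ (y _)]
  split_ifs <;> simp

theorem sum_atQubit {O : Type} [Fintype O] (q : Q) (A : O → Matrix (Fin 2) (Fin 2) ℂ) :
    ∑ o, atQubit q (A o) = atQubit q (∑ o, A o) := by
  ext x y
  simp only [atQubit, Matrix.sum_apply, Matrix.of_apply]
  split_ifs <;> simp

theorem atQubit_one (q : Q) : atQubit q (1 : Matrix (Fin 2) (Fin 2) ℂ) = 1 := by
  refine Matrix.ext_of_mulVec_single fun y => ?_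
  rw [Matrix.one_mulVec]
  funext x
  rw [atQubit_mulVec]
  simp [Matrix.one_apply]

variable [Fintype V] [DecidableEq V]

variable (loc) in
/-- `K` acts on the qubits at the node `p` only. -/
def IsLocalAt (p : V) (K : Matrix (Q → Fin 2) (Q → Fin 2) ℂ) : Prop :=
  ∃ k : Matrix (NodeBits loc p) (NodeBits loc p) ℂ,
    K.submatrix (ungroup loc) (ungroup loc) = tensorOp (Function.update (fun _ => 1) p k)

omit [DecidableEq Q] in
-- By `h₀` the operator is diagonal in the qubits away from `p`, and by `h₁` its entries do not see
-- their common values. The local matrix is read off with the far bits set to 0.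
theorem isLocalAt_of {p : V} {K : Matrix (Q → Fin 2) (Q → Fin 2) ℂ}
    (h₀ : ∀ x y q, loc q ≠ p → x q ≠ y q → K x y = 0)
    (h₁ : ∀ x y x' y', (∀ q, loc q = p → x q = x' q ∧ y q = y' q) →
      (∀ q, loc q ≠ p → x q = y q ∧ x' q = y' q) → K x y = K x' y') : IsLocalAt loc p K := by
  let ext : NodeBits loc p → Q → Fin 2 := fun u q => if h : loc q = p then u ⟨q, h⟩ else 0
  refine ⟨Matrix.of fun u w => K (ext u) (ext w), ?_⟩
  ext x y
  rw [Matrix.submatrix_apply, tensorOp, Matrix.of_apply, ← Finset.mul_prod_erase _ _ (Finset.mem_univ p),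
    Function.update_self, Matrix.of_apply]
  have hp : ∀ (x : ∀ v, NodeBits loc v) (q : Q), loc q = p → ungroup loc x q = ext (x p) q := by
    intro x q hq
    subst hq
    simp [ungroup, ext]
  by_cases hxy : ∀ v, v ≠ p → x v = y v
  · rw [Finset.prod_eq_one, mul_one]
    · refine h₁ _ _ _ _ (fun q hq => ⟨hp x q hq, hp y q hq⟩) fun q hq => ⟨?_, ?_⟩
      · exact congrFun (hxy _ hq) _
      · simp [ext, hq]
    · intro v hv
      rw [Function.update_of_ne (Finset.ne_of_mem_erase hv), hxy v (Finset.ne_of_mem_erase hv),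
        Matrix.one_apply_eq]
  · push Not at hxy
    obtain ⟨v, hv, hxv⟩ := hxy
    obtain ⟨⟨q, hq⟩, hxq⟩ := Function.ne_iff.1 hxv
    rw [Finset.prod_eq_zero (Finset.mem_erase.2 ⟨hv, Finset.mem_univ v⟩), mul_zero]
    · subst hq
      exact h₀ _ _ q hv hxq
    · rw [Function.update_of_ne hv, Matrix.one_apply_ne hxv]

theorem isLocalAt_atQubit (q : Q) (A : Matrix (Fin 2) (Fin 2) ℂ) :
    IsLocalAt loc (loc q) (atQubit q A) := by
  refine isLocalAt_of (fun x y j hj hxy => ?_) fun x y x' y' h h' => ?_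
  · rw [atQubit, Matrix.of_apply, if_neg]
    intro hall
    exact hxy (hall j fun hjq => hj (hjq ▸ rfl))
  · simp only [atQubit, Matrix.of_apply, (h q rfl).1, (h q rfl).2]
    congr 1
    refine propext (forall₂_congr fun j hj => ?_)
    by_cases hjp : loc j = loc q
    · rw [(h j hjp).1, (h j hjp).2]
    · simp [(h' j hjp).1, (h' j hjp).2]

omit [DecidableEq Q] in
theorem isLocalAt_diagonal {p : V} {f : (Q → Fin 2) → ℂ}
    (hf : ∀ x y, (∀ q, loc q = p → x q = y q) → f x = f y) :
    IsLocalAt loc p (Matrix.diagonal f) := by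
  classical
  refine isLocalAt_of (fun x y j hj hxy => ?_) fun x y x' y' h h' => ?_
  · rw [Matrix.diagonal_apply_ne]
    exact fun he => hxy (congrFun he j)
  · simp only [Matrix.diagonal_apply, hf x x' fun q hq => (h q hq).1]
    congr 1
    simp only [funext_iff]
    refine propext (forall_congr' fun j => ?_)
    by_cases hjp : loc j = p
    · rw [(h j hjp).1, (h j hjp).2]
    · simp [(h' j hjp).1, (h' j hjp).2]

variable {κ : V → Type} {Ψ : Type} {φ : Ψ → (Q → Fin 2) → ℂ} {χ : Ψ → (∀ v, κ v) → ℂ}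

variable (loc) in
/-- `Reaches` for a family of states of qubits that are placed at the nodes by `loc`. -/
def QubitReaches (φ : Ψ → (Q → Fin 2) → ℂ) (χ : Ψ → (∀ v, κ v) → ℂ) : Prop :=
  Reaches (fun ψ x => φ ψ (ungroup loc x)) χ

omit [Fintype Q] [DecidableEq Q] in
theorem QubitReaches.smul (h : QubitReaches loc φ χ) (c : ℂ) :
    QubitReaches loc (fun ψ x => c * φ ψ x) χ :=
  Reaches.smul h c

theorem QubitReaches.instrument {O : Type} [Fintype O] (p : V)
    (K : O → Matrix (Q → Fin 2) (Q → Fin 2) ℂ) (hK : ∀ o, IsLocalAt loc p (K o))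
    (hsum : ∑ o, (K o)ᴴ * K o = 1) (h : ∀ o, QubitReaches loc (fun ψ => K o *ᵥ φ ψ) χ) :
    QubitReaches loc φ χ := by
  choose k hk using hK
  let u : (∀ v, NodeBits loc v) ≃ (Q → Fin 2) := Equiv.ofBijective _ (ungroup_bijective loc)
  have hu : ∀ A B : Matrix (Q → Fin 2) (Q → Fin 2) ℂ,
      (A * B).submatrix (ungroup loc) (ungroup loc) =
        A.submatrix (ungroup loc) (ungroup loc) * B.submatrix (ungroup loc) (ungroup loc) :=
    fun A B => (Matrix.submatrix_mul_equiv A B _ u _).symm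
  refine Reaches.round p (fun o => Function.update (fun _ => 1) p (k o)) ?_ ?_ ?_
  · have h₁ : tensorOp (Function.update (fun v => (1 : Matrix (NodeBits loc v) (NodeBits loc v) ℂ)) p
        (∑ o, (k o)ᴴ * k o)) = 1 := by
      rw [← sum_tensorOp_update, ← (Matrix.submatrix_one_equiv u), ← hsum]
      ext x y
      rw [Matrix.submatrix_apply, Matrix.sum_apply, Matrix.sum_apply]
      refine Finset.sum_congr rfl fun o _ => ?_
      change _ = ((K o)ᴴ * K o).submatrix (ungroup loc) (ungroup loc) x y
      rw [hu, ← Matrix.conjTranspose_submatrix, hk, conjTranspose_tensorOp, tensorOp_mul]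
      congr 2
      funext v
      by_cases hv : v = p
      · subst hv; simp
      · simp [Function.update_of_ne hv]
    simp only [Function.update_self]
    ext a b
    -- Completeness is known for the joint operators; entries at labels that vanish at every other
    -- node give it for the factor at `p`.
    have h₂ := congrFun (congrFun h₁ (Function.update (fun _ _ => 0) p a))
      (Function.update (fun _ _ => 0) p b)
    rw [tensorOp, Matrix.of_apply, ← Finset.mul_prod_erase _ _ (Finset.mem_univ p),
      Finset.prod_eq_one, mul_one] at h₂
    · simp only [Function.update_self] at h₂
      rw [h₂, Matrix.one_apply, Matrix.one_apply]
      congr 1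
      exact propext (Function.update_injective _ p).eq_iff
    · intro v hv
      have hv := Finset.ne_of_mem_erase hv
      simp [Function.update_of_ne hv]
  · intro o v hv
    simp [Function.update_of_ne hv]
  · intro o
    have h₁ := h o
    rw [QubitReaches] at h₁
    convert h₁ using 3 with ψ x
    rw [← hk]
    exact Matrix.submatrix_mulVec_equiv (K o) (φ ψ ∘ u) u u ▸ by
      simp [Function.comp_assoc]; rfl

theorem QubitReaches.oneQubitInstrument {O : Type} [Fintype O] (q : Q)
    (A : O → Matrix (Fin 2) (Fin 2) ℂ) (hsum : ∑ o, (A o)ᴴ * A o = 1)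
    (h : ∀ o, QubitReaches loc (fun ψ x => ∑ b, A o (x q) b * φ ψ (Function.update x q b)) χ) :
    QubitReaches loc φ χ := by
  refine .instrument (loc q) (fun o => atQubit q (A o)) (fun o => isLocalAt_atQubit q _) ?_ ?_
  · simp only [conjTranspose_atQubit, atQubit_mul, sum_atQubit, hsum, atQubit_one]
  · intro o
    convert h o using 2 with ψ
    funext x
    exact atQubit_mulVec ..

theorem QubitReaches.unitary (q : Q) (A : Matrix (Fin 2) (Fin 2) ℂ) (hA : Aᴴ * A = 1)
    (h : QubitReaches loc (fun ψ x => ∑ b, A (x q) b * φ ψ (Function.update x q b)) χ) :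
    QubitReaches loc φ χ :=
  .oneQubitInstrument (O := Unit) q (fun _ => A) (by simpa using hA) fun _ => h

theorem QubitReaches.phase (p : V) (f : (Q → Fin 2) → ℂ)
    (hf : ∀ x y, (∀ q, loc q = p → x q = y q) → f x = f y) (hf₁ : ∀ x, ‖f x‖ = 1)
    (h : QubitReaches loc (fun ψ x => f x * φ ψ x) χ) : QubitReaches loc φ χ := by
  refine .instrument (O := Unit) p (fun _ => Matrix.diagonal f) (fun _ => isLocalAt_diagonal hf) ?_ ?_
  · simp only [Finset.univ_unique, Finset.sum_singleton, Matrix.diagonal_conjTranspose,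
      Matrix.diagonal_mul_diagonal]
    rw [← Matrix.diagonal_one]
    congr 1
    funext x
    rw [Pi.star_apply, RCLike.star_def, RCLike.conj_mul, hf₁]
    simp
  · intro _
    convert h using 2 with ψ
    funext x
    exact Matrix.mulVec_diagonal ..

end Qubits

/-! ### Gadgets that consume an EPR pair -/

/-- `(-1) ^ (a b)`. -/
def bitSign (a b : Fin 2) : ℂ := if a = 1 ∧ b = 1 then -1 else 1

theorem hadamard_apply (a b : Fin 2) : hadamard a b = ((1 / √2 : ℝ) : ℂ) * bitSign a b := by
  fin_cases a <;> fin_cases b <;> simp [hadamard, bitSign]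

theorem inv_sqrt_two_mul_self : ((1 / √2 : ℝ) : ℂ) * ((1 / √2 : ℝ) : ℂ) = 1 / 2 := by
  rw [← Complex.ofReal_mul, div_mul_div_comm, Real.mul_self_sqrt (by norm_num)]
  norm_num

theorem conjTranspose_hadamard : hadamardᴴ = hadamard := by
  ext a b
  fin_cases a <;> fin_cases b <;> simp [hadamard]

theorem hadamard_mul_self : hadamard * hadamard = 1 := by
  have h := inv_sqrt_two_mul_self
  ext a b
  simp only [Matrix.mul_apply, hadamard_apply, Fin.sum_univ_two, Matrix.one_apply]
  generalize ((1 / √2 : ℝ) : ℂ) = r at h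
  fin_cases a <;> fin_cases b <;> simp [bitSign] <;> linear_combination 2 * h

theorem norm_bitSign (a b : Fin 2) : ‖bitSign a b‖ = 1 := by
  unfold bitSign
  split_ifs <;> simp

section Gadgets

variable {V Q : Type} [Fintype Q] [DecidableEq Q] [Fintype V] [DecidableEq V] {loc : Q → V}
  {κ : V → Type} {Ψ : Type} {φ g : Ψ → (Q → Fin 2) → ℂ} {χ : Ψ → (∀ v, κ v) → ℂ}

/-- The Kraus operators have equal rows, so the measured qubit is left in a multiple of |0⟩ + |1⟩
and later amplitudes do not depend on its bit. Used qubits can therefore stay in place until the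
end. The same device serves in `measureZ`. -/
theorem QubitReaches.measureX (q : Q)
    (h : ∀ s, QubitReaches loc (fun ψ x => ∑ b, bitSign s b * φ ψ (Function.update x q b)) χ) :
    QubitReaches loc φ χ := by
  refine .oneQubitInstrument q (fun s => Matrix.of fun _ b => 1 / 2 * bitSign s b) ?_ fun s => ?_
  · ext a b
    fin_cases a <;> fin_cases b <;>
      simp [Matrix.mul_apply, Matrix.conjTranspose_apply, Fin.sum_univ_two, bitSign] <;> norm_num
  · convert (h s).smul (1 / 2) using 3 with ψ x
    simp only [Matrix.of_apply, Finset.mul_sum, mul_assoc]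

theorem QubitReaches.measureZ (q : Q)
    (h : ∀ m, QubitReaches loc (fun ψ x => φ ψ (Function.update x q m)) χ) :
    QubitReaches loc φ χ := by
  refine .oneQubitInstrument q
    (fun m => Matrix.of fun _ b => if b = m then ((1 / √2 : ℝ) : ℂ) else 0) ?_ fun s => ?_
  · have h := inv_sqrt_two_mul_self
    ext a b
    simp only [Matrix.sum_apply, Matrix.mul_apply, Matrix.conjTranspose_apply, Matrix.of_apply,
      Fin.sum_univ_two, Matrix.one_apply]
    have hs : star ((1 / √2 : ℝ) : ℂ) = ((1 / √2 : ℝ) : ℂ) := Complex.conj_ofReal _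
    generalize ((1 / √2 : ℝ) : ℂ) = r at h hs
    fin_cases a <;> fin_cases b <;> simp [-RCLike.star_def, hs] <;> linear_combination 2 * h
  · convert (h s).smul ((1 / √2 : ℝ) : ℂ) using 3 with ψ x
    simp

theorem QubitReaches.flip (q : Q) (s : Fin 2)
    (h : QubitReaches loc (fun ψ x => φ ψ (Function.update x q (x q + s))) χ) :
    QubitReaches loc φ χ := by
  refine .unitary q (Matrix.of fun a b => if b = a + s then 1 else 0) ?_ ?_
  · ext a b
    fin_cases s <;> fin_cases a <;> fin_cases b <;>
      simp [Matrix.mul_apply, Matrix.conjTranspose_apply, Fin.sum_univ_two]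
  · convert h using 3 with ψ x
    simp

/-- An EPR pair on `e₀` and `e₁` serves to copy the bit of `c`, which is where `e₀` is, to `e₁`. -/
theorem QubitReaches.copy {e₀ e₁ c : Q} (h₀₁ : e₀ ≠ e₁) (hc₀ : c ≠ e₀) (hc₁ : c ≠ e₁)
    (hloc : loc c = loc e₀) (hg₀ : ∀ ψ x b, g ψ (Function.update x e₀ b) = g ψ x)
    (hg₁ : ∀ ψ x b, g ψ (Function.update x e₁ b) = g ψ x)
    (h : QubitReaches loc (fun ψ x => (if x e₁ = x c then 1 else 0) * g ψ x) χ) :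
    QubitReaches loc (fun ψ x => (if x e₀ = x e₁ then 1 else 0) * g ψ x) χ := by
  -- Hadamard, controlled sign and X measurement together measure the parity `s` of `e₀` and `c`. As
  -- `e₁` agrees with `e₀`, flipping it by `s` makes it agree with `c`.
  refine .unitary e₀ hadamard (by rw [conjTranspose_hadamard, hadamard_mul_self]) ?_
  refine .phase (loc e₀) (fun x => bitSign (x e₀) (x c))
    (fun x y hxy => by rw [hxy e₀ rfl, hxy c hloc]) (fun x => norm_bitSign _ _) ?_
  refine .measureX e₀ fun s => ?_
  refine .flip e₁ s ?_
  convert h.smul (2 * ((1 / √2 : ℝ) : ℂ)) using 3 with ψ x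
  simp only [Fin.sum_univ_two, Function.update_self, Function.update_of_ne hc₀,
    Function.update_of_ne hc₁, Function.update_of_ne h₀₁.symm, hg₀, hg₁, hadamard_apply]
  generalize g ψ x = z
  generalize x e₁ = a
  generalize x c = b
  generalize ((1 / √2 : ℝ) : ℂ) = r
  fin_cases s <;> fin_cases a <;> fin_cases b <;> simp [bitSign] <;> ring

/-- The converse of copying. -/
theorem QubitReaches.uncopy {e c : Q} (hc : c ≠ e)
    (hg : ∀ ψ x b, g ψ (Function.update x e b) = g ψ x) (h : QubitReaches loc g χ) :
    QubitReaches loc (fun ψ x => (if x e = x c then 1 else 0) * g ψ x) χ := by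
  -- Since `e` agrees with `c`, outcome `s` leaves the sign (-1)^(s·x c), which a phase at the node
  -- of `c` cancels.
  refine .measureX e fun s => ?_
  refine .phase (loc c) (fun x => bitSign s (x c)) (fun x y hxy => by rw [hxy c rfl])
    (fun x => norm_bitSign _ _) ?_
  convert h using 3 with ψ x
  simp only [Fin.sum_univ_two, Function.update_self, Function.update_of_ne hc, hg]
  generalize g ψ x = z
  generalize x c = b
  fin_cases s <;> fin_cases b <;> simp [bitSign]

/-- After copying, the roles are exchanged: `c` is regarded as a copy of `e₁` and erased. -/
theorem QubitReaches.teleport {e₀ e₁ c : Q} (h₀₁ : e₀ ≠ e₁) (hc₀ : c ≠ e₀) (hc₁ : c ≠ e₁)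
    (hloc : loc c = loc e₀) (hg₀ : ∀ ψ x b, g ψ (Function.update x e₀ b) = g ψ x)
    (hg₁ : ∀ ψ x b, g ψ (Function.update x e₁ b) = g ψ x)
    (h : QubitReaches loc (fun ψ x => g ψ (Function.update x c (x e₁))) χ) :
    QubitReaches loc (fun ψ x => (if x e₀ = x e₁ then 1 else 0) * g ψ x) χ := by
  refine .copy h₀₁ hc₀ hc₁ hloc hg₀ hg₁ ?_
  have h' := QubitReaches.uncopy (e := c) (c := e₁) hc₁.symm (fun ψ x b => by
    rw [Function.update_of_ne hc₁.symm, Function.update_idem]) h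
  convert h' using 3 with ψ x
  split_ifs with h₁ h₂ h₂
  · rw [h₁, Function.update_eq_self]
  · exact absurd h₁.symm h₂
  · exact absurd h₂.symm h₁
  · simp

/-- An EPR pair serves to apply a phase that depends on a distant bit. -/
theorem QubitReaches.interact {e₀ e₁ c : Q} (h₀₁ : e₀ ≠ e₁) (hc₀ : c ≠ e₀) (hc₁ : c ≠ e₁)
    (hloc : loc c = loc e₀) (hg₀ : ∀ ψ x b, g ψ (Function.update x e₀ b) = g ψ x)
    (hg₁ : ∀ ψ x b, g ψ (Function.update x e₁ b) = g ψ x) (f : Fin 2 → (Q → Fin 2) → ℂ)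
    (hf : ∀ a x y, (∀ q, loc q = loc e₁ → x q = y q) → f a x = f a y)
    (hf₁ : ∀ a x, ‖f a x‖ = 1) (hfe : ∀ a x b, f a (Function.update x e₁ b) = f a x)
    (h : QubitReaches loc (fun ψ x => f (x c) x * g ψ x) χ) :
    QubitReaches loc (fun ψ x => (if x e₀ = x e₁ then 1 else 0) * g ψ x) χ := by
  refine .copy h₀₁ hc₀ hc₁ hloc hg₀ hg₁ ?_
  refine .phase (loc e₁) (fun x => f (x e₁) x) (fun x y hxy => by rw [hxy e₁ rfl, hf _ x y hxy])
    (fun x => hf₁ _ _) ?_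
  have h' := QubitReaches.uncopy (e := e₁) (c := c) hc₁ (fun ψ x b => by
    rw [Function.update_of_ne hc₁, hfe, hg₁]) h
  convert h' using 3 with ψ x
  split_ifs with h₁
  · rw [h₁]; ring
  · ring

/-- Two EPR pairs serve to apply a phase that depends on two distant bits. -/
theorem QubitReaches.interact₂ {e₀ e₁ c e₀' e₁' c' : Q} (h₀₁ : e₀ ≠ e₁) (hc₀ : c ≠ e₀)
    (hc₁ : c ≠ e₁) (h₀₁' : e₀' ≠ e₁') (hc₀' : c' ≠ e₀') (hc₁' : c' ≠ e₁')
    (h₀₀ : e₀ ≠ e₀') (h₀₁'' : e₀ ≠ e₁') (h₁₀ : e₁ ≠ e₀') (h₁₁ : e₁ ≠ e₁') (hcc₁ : c ≠ e₁')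
    (hcc₀ : c ≠ e₀') (hcc₁' : c' ≠ e₁) (hloc : loc c = loc e₀) (hloc' : loc c' = loc e₀')
    (hloc₁ : loc e₁' = loc e₁)
    (hg₀ : ∀ ψ x b, g ψ (Function.update x e₀ b) = g ψ x)
    (hg₁ : ∀ ψ x b, g ψ (Function.update x e₁ b) = g ψ x)
    (hg₀' : ∀ ψ x b, g ψ (Function.update x e₀' b) = g ψ x)
    (hg₁' : ∀ ψ x b, g ψ (Function.update x e₁' b) = g ψ x)
    (f : Fin 2 → Fin 2 → (Q → Fin 2) → ℂ)
    (hf : ∀ a a' x y, (∀ q, loc q = loc e₁ → x q = y q) → f a a' x = f a a' y)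
    (hf₁ : ∀ a a' x, ‖f a a' x‖ = 1)
    (hfe : ∀ a a' x b, f a a' (Function.update x e₁ b) = f a a' x)
    (hfe' : ∀ a a' x b, f a a' (Function.update x e₁' b) = f a a' x)
    (h : QubitReaches loc (fun ψ x => f (x c) (x c') x * g ψ x) χ) :
    QubitReaches loc (fun ψ x => (if x e₀ = x e₁ then 1 else 0) *
      ((if x e₀' = x e₁' then 1 else 0) * g ψ x)) χ := by
  refine .copy h₀₁ hc₀ hc₁ hloc (fun ψ x b => ?_) (fun ψ x b => ?_) ?_
  · rw [Function.update_of_ne h₀₀.symm, Function.update_of_ne h₀₁''.symm, hg₀]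
  · rw [Function.update_of_ne h₁₀.symm, Function.update_of_ne h₁₁.symm, hg₁]
  have h₁ : QubitReaches loc (fun ψ x => (if x e₁ = x c then 1 else 0) *
      (f (x c) (x c') x * g ψ x)) χ :=
    .uncopy hc₁ (fun ψ x b => by
      rw [Function.update_of_ne hc₁, Function.update_of_ne hcc₁', hfe, hg₁]) h
  -- While the first copy is alive at `e₁`, the second pair is used with a phase that reads this
  -- copy; `hloc₁` makes that phase local. Only then is the first copy erased, by `h₁`.
  have h₂ : QubitReaches loc (fun ψ x => (if x e₀' = x e₁' then 1 else 0) *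
      ((if x e₁ = x c then 1 else 0) * g ψ x)) χ := by
    refine .interact h₀₁' hc₀' hc₁' hloc' (fun ψ x b => ?_) (fun ψ x b => ?_)
      (fun a' x => f (x e₁) a' x) (fun a' x y hxy => ?_) (fun a' x => hf₁ _ _ _)
      (fun a' x b => ?_) ?_
    · rw [Function.update_of_ne h₁₀, Function.update_of_ne hcc₀, hg₀']
    · rw [Function.update_of_ne h₁₁, Function.update_of_ne hcc₁, hg₁']
    · rw [hloc₁] at hxy
      rw [hxy e₁ rfl, hf _ _ x y hxy]
    · rw [Function.update_of_ne h₁₁, hfe']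
    · convert h₁ using 3 with ψ x
      split_ifs with h₃
      · rw [h₃]; ring
      · ring
  convert h₂ using 3 with ψ x
  ring

end Gadgets

namespace Network

/-! ### Logical qubits on a network -/

variable {V : Type} [Fintype V] [DecidableEq V] {k : ℕ} {G : Network V k} {L : Type}
  {κ : V → Type} {Ψ : Type} {χ : Ψ → (∀ v, κ v) → ℂ}

variable (G) in
/-- The EPR pairs of the edges in `E` (not normalised) together with the state `θ` of logical qubits
at the positions `pos`; the other qubits are in the state `|0⟩ + |1⟩`. -/
def state (E : Finset G.edges) (pos : L → G.Qubit) (θ : Ψ → (L → Fin 2) → ℂ) :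
    Ψ → (G.Qubit → Fin 2) → ℂ :=
  fun ψ x => (∏ e ∈ E, if x (.inr (e, 0)) = x (.inr (e, 1)) then 1 else 0) * θ ψ fun l => x (pos l)

/-- The logical qubits have different positions, away from the EPR pairs of the edges in `E`. -/
structure Admissible (E : Finset G.edges) (pos : L → G.Qubit) : Prop where
  injective : Function.Injective pos
  ne : ∀ l, ∀ e ∈ E, ∀ b, pos l ≠ .inr (e, b)

variable {E : Finset G.edges} {pos : L → G.Qubit} {θ : Ψ → (L → Fin 2) → ℂ}

omit [Fintype V] in
theorem Admissible.erase (h : Admissible E pos) (e : G.edges) : Admissible (E.erase e) pos :=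
  ⟨h.injective, fun l e' he' => h.ne l e' (Finset.mem_of_mem_erase he')⟩

omit [Fintype V] in
theorem Admissible.update [DecidableEq L] (h : Admissible E pos) {e : G.edges} (he : e ∈ E)
    (l : L) (b : Fin 2) : Admissible (E.erase e) (Function.update pos l (.inr (e, b))) := by
  refine ⟨fun l₁ l₂ h₁₂ => ?_, fun l₁ e' he' b' => ?_⟩
  · by_cases h₁ : l₁ = l <;> by_cases h₂ : l₂ = l
    · rw [h₁, h₂]
    · subst h₁
      rw [Function.update_self, Function.update_of_ne h₂] at h₁₂
      exact absurd h₁₂.symm (h.ne _ e he b)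
    · subst h₂
      rw [Function.update_self, Function.update_of_ne h₁] at h₁₂
      exact absurd h₁₂ (h.ne _ e he b)
    · rw [Function.update_of_ne h₁, Function.update_of_ne h₂] at h₁₂
      exact h.injective h₁₂
  · by_cases h₁ : l₁ = l
    · subst h₁
      rw [Function.update_self]
      intro heq
      simp only [Sum.inr.injEq, Prod.mk.injEq] at heq
      exact Finset.ne_of_mem_erase he' heq.1.symm
    · rw [Function.update_of_ne h₁]
      exact h.ne _ _ (Finset.mem_of_mem_erase he') _

omit [Fintype V] in
theorem Admissible.option (h : Admissible E pos) {e : G.edges} (he : e ∈ E) (b : Fin 2) :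
    Admissible (E.erase e) (fun o : Option L => o.elim (.inr (e, b)) pos) := by
  refine ⟨fun l₁ l₂ h₁₂ => ?_, fun l₁ e' he' b' => ?_⟩
  · match l₁, l₂ with
    | none, none => rfl
    | none, some l => exact absurd h₁₂.symm (h.ne l e he b)
    | some l, none => exact absurd h₁₂ (h.ne l e he b)
    | some l, some l' => rw [h.injective h₁₂]
  · match l₁ with
    | none =>
      simp only [Option.elim_none, ne_eq, Sum.inr.injEq, Prod.mk.injEq, not_and]
      exact fun heq => absurd heq.symm (Finset.ne_of_mem_erase he')
    | some l => exact h.ne l e' (Finset.mem_of_mem_erase he') b'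

omit [Fintype V] in
-- The parameter `b` selects the end from which the EPR pair will be used, since an edge may be
-- traversed in either direction.
theorem state_eq_of_mem {e : G.edges} (he : e ∈ E) (b : Fin 2) :
    state G E pos θ = fun ψ x =>
      (if x (.inr (e, b)) = x (.inr (e, b + 1)) then 1 else 0) * state G (E.erase e) pos θ ψ x := by
  funext ψ x
  rw [state, state, ← Finset.mul_prod_erase _ _ he, mul_assoc]
  congr 2
  fin_cases b
  · rfl
  · exact propext eq_comm

omit [Fintype V] in
theorem state_update_half (h : Admissible E pos) {e : G.edges} (he : e ∈ E) (b : Fin 2) (ψ : Ψ)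
    (x : G.Qubit → Fin 2) (a : Fin 2) :
    state G (E.erase e) pos θ ψ (Function.update x (.inr (e, b)) a) =
      state G (E.erase e) pos θ ψ x := by
  rw [state, state]
  congr 1
  · refine Finset.prod_congr rfl fun e' he' => ?_
    have := Finset.ne_of_mem_erase he'
    simp [Function.update_of_ne, this]
  · congr 1
    funext l
    exact Function.update_of_ne (h.ne l e he b) ..

omit [Fintype V] in
theorem state_update_pos [DecidableEq L] (h : Admissible E pos) (l : L) (ψ : Ψ)
    (x : G.Qubit → Fin 2) (a : Fin 2) :
    state G E pos θ ψ (Function.update x (pos l) a) =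
      (∏ e ∈ E, if x (.inr (e, 0)) = x (.inr (e, 1)) then 1 else 0) *
        θ ψ (Function.update (fun l => x (pos l)) l a) := by
  rw [state]
  congr 1
  · refine Finset.prod_congr rfl fun e he => ?_
    rw [Function.update_of_ne (h.ne l e he 0).symm, Function.update_of_ne (h.ne l e he 1).symm]
  · congr 1
    exact Function.update_comp_eq_of_injective x h.injective l a

omit [Fintype V] [DecidableEq V] in
theorem half_ne (e : G.edges) (b : Fin 2) : (.inr (e, b) : G.Qubit) ≠ .inr (e, b + 1) := by
  fin_cases b <;> simp

theorem reaches_teleport [DecidableEq L] (h : Admissible E pos) {e : G.edges} (he : e ∈ E)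
    (b : Fin 2) (l : L) (hloc : G.loc (pos l) = G.loc (.inr (e, b)))
    (hr : QubitReaches G.loc
      (state G (E.erase e) (Function.update pos l (.inr (e, b + 1))) θ) χ) :
    QubitReaches G.loc (state G E pos θ) χ := by
  rw [state_eq_of_mem he b]
  refine .teleport (half_ne e b) (h.ne l e he b) (h.ne l e he _) hloc
    (state_update_half h he b) (state_update_half h he _) ?_
  convert hr using 3 with ψ x
  rw [state_update_pos (h.erase e), state]
  congr 2
  funext l'
  by_cases hl : l' = l
  · subst hl; simp
  · simp [hl]

theorem reaches_interact (h : Admissible E pos) {e : G.edges} (he : e ∈ E) (b : Fin 2) (l : L)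
    (hloc : G.loc (pos l) = G.loc (.inr (e, b))) (f : Fin 2 → (L → Fin 2) → ℂ)
    (hf : ∀ a y y', (∀ l', G.loc (pos l') = G.loc (.inr (e, b + 1)) → y l' = y' l') →
      f a y = f a y') (hf₁ : ∀ a y, ‖f a y‖ = 1)
    (hr : QubitReaches G.loc (state G (E.erase e) pos fun ψ y => f (y l) y * θ ψ y) χ) :
    QubitReaches G.loc (state G E pos θ) χ := by
  rw [state_eq_of_mem he b]
  refine .interact (half_ne e b) (h.ne l e he b) (h.ne l e he _) hloc
    (state_update_half h he b) (state_update_half h he _) (fun a x => f a fun l => x (pos l))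
    (fun a x y hxy => hf _ _ _ fun l' hl' => hxy _ hl') (fun a x => hf₁ _ _) (fun a x b' => ?_) ?_
  · congr 1
    funext l'
    rw [Function.update_of_ne (h.ne l' e he _)]
  · convert hr using 3 with ψ x
    rw [state, state]
    ring

theorem reaches_interact₂ (h : Admissible E pos) {e e' : G.edges} (he : e ∈ E) (he' : e' ∈ E)
    (hee' : e ≠ e') (b b' : Fin 2) (l l' : L) (hloc : G.loc (pos l) = G.loc (.inr (e, b)))
    (hloc' : G.loc (pos l') = G.loc (.inr (e', b')))
    (hloc₁ : G.loc (.inr (e', b' + 1)) = G.loc (.inr (e, b + 1)))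
    (f : Fin 2 → Fin 2 → (L → Fin 2) → ℂ)
    (hf : ∀ a a' y y', (∀ l', G.loc (pos l') = G.loc (.inr (e, b + 1)) → y l' = y' l') →
      f a a' y = f a a' y') (hf₁ : ∀ a a' y, ‖f a a' y‖ = 1)
    (hr : QubitReaches G.loc
      (state G ((E.erase e).erase e') pos fun ψ y => f (y l) (y l') y * θ ψ y) χ) :
    QubitReaches G.loc (state G E pos θ) χ := by
  have he'' : e' ∈ E.erase e := Finset.mem_erase.2 ⟨hee'.symm, he'⟩
  have he''' : e ∈ E.erase e' := Finset.mem_erase.2 ⟨hee', he⟩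
  rw [state_eq_of_mem he b, state_eq_of_mem he'' b']
  have hne : ∀ b b', (.inr (e, b) : G.Qubit) ≠ .inr (e', b') := by simp [hee']
  have hne' : ∀ b b', (.inr (e', b) : G.Qubit) ≠ .inr (e, b') := by simp [hee'.symm]
  refine .interact₂ (half_ne e b) (h.ne l e he b) (h.ne l e he _) (half_ne e' b')
    (h.ne l' e' he' b') (h.ne l' e' he' _) (hne _ _) (hne _ _) (hne _ _) (hne _ _)
    (h.ne l e' he' _) (h.ne l e' he' _) (h.ne l' e he _) hloc hloc' hloc₁
    ?_ ?_ (state_update_half (h.erase e) he'' b') (state_update_half (h.erase e) he'' _)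
    (fun a a' x => f a a' fun l => x (pos l))
    (fun a a' x y hxy => hf _ _ _ _ fun l' hl' => hxy _ hl') (fun a a' x => hf₁ _ _ _)
    (fun a a' x b'' => ?_) (fun a a' x b'' => ?_) ?_
  · rw [Finset.erase_right_comm]
    exact state_update_half (h.erase e') he''' b
  · rw [Finset.erase_right_comm]
    exact state_update_half (h.erase e') he''' _
  · congr 1
    funext l'
    rw [Function.update_of_ne (h.ne l' e he _)]
  · congr 1
    funext l
    rw [Function.update_of_ne (h.ne l e' he' _)]
  · convert hr using 3 with ψ x
    rw [state, state]
    ring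

theorem reaches_copy (h : Admissible E pos) {e : G.edges} (he : e ∈ E) (b : Fin 2) (l : L)
    (hloc : G.loc (pos l) = G.loc (.inr (e, b)))
    (hr : QubitReaches G.loc (state G (E.erase e) (fun o : Option L => o.elim (.inr (e, b + 1)) pos)
      fun ψ y => (if y none = y (some l) then 1 else 0) * θ ψ fun l => y (some l)) χ) :
    QubitReaches G.loc (state G E pos θ) χ := by
  rw [state_eq_of_mem he b]
  refine .copy (half_ne e b) (h.ne l e he b) (h.ne l e he _) hloc
    (state_update_half h he b) (state_update_half h he _) ?_
  convert hr using 3 with ψ x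
  simp only [state, Option.elim_none, Option.elim_some]
  exact mul_left_comm _ _ _

theorem reaches_unitary [DecidableEq L] (h : Admissible E pos) (l : L)
    (A : Matrix (Fin 2) (Fin 2) ℂ) (hA : Aᴴ * A = 1)
    (hr : QubitReaches G.loc (state G E pos fun ψ y =>
      ∑ a, A (y l) a * θ ψ (Function.update y l a)) χ) :
    QubitReaches G.loc (state G E pos θ) χ := by
  refine .unitary (pos l) A hA ?_
  convert hr using 3 with ψ x
  simp only [state_update_pos h]
  rw [state, Finset.mul_sum]
  exact Finset.sum_congr rfl fun a _ => by ring

theorem reaches_measure {pos : Option L → G.Qubit} {θ : Ψ → (Option L → Fin 2) → ℂ}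
    (h : Admissible E pos)
    (hr : ∀ m, QubitReaches G.loc (state G E (fun l => pos (some l)) fun ψ y =>
      θ ψ fun o => o.elim m y) χ) :
    QubitReaches G.loc (state G E pos θ) χ := by
  classical
  refine .measureZ (pos none) fun m => ?_
  convert hr m using 3 with ψ x
  rw [state_update_pos h, state]
  congr 2
  funext o
  cases o <;> simp

/-- What remains is discarded at the end. -/
theorem reaches_output {pos : Fin k → G.Qubit} (hpos : Function.Injective pos)
    (hloc : ∀ i, G.loc (pos i) = G.output i) (θ : Ψ → (Fin k → Fin 2) → ℂ) :
    QubitReaches G.loc (state G ∅ pos θ) (fun ψ x => θ ψ (ungroup G.output x)) := by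
  classical
  -- The bits at a node split into those of the output qubits and the rest; the state is constant in
  -- the rest, as discarding requires.
  let E : ∀ v, NodeBits G.loc v ≃
      NodeBits G.output v × ({q : QubitsAt G.loc v // ¬ ∃ i, pos i = q.1} → Fin 2) := fun v =>
    { toFun := fun w => (fun i => w ⟨pos i.1, (hloc i.1).trans i.2⟩, fun q => w q.1)
      invFun := fun u q => if h : ∃ i, pos i = q.1
        then u.1 ⟨h.choose, by rw [← hloc, h.choose_spec, q.2]⟩ else u.2 ⟨q, h⟩
      left_inv := fun w => by
        funext q
        dsimp only
        split_ifs with h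
        · congr 1
          exact Subtype.ext h.choose_spec
        · rfl
      right_inv := fun u => by
        refine Prod.ext ?_ ?_
        · funext i
          have h : ∃ j, pos j = pos i.1 := ⟨i.1, rfl⟩
          dsimp only
          rw [dif_pos h]
          exact congrArg u.1 (Subtype.ext (hpos h.choose_spec))
        · funext q
          dsimp only
          rw [dif_neg q.2] }
  have h := Reaches.discard E fun ψ x => θ ψ (ungroup G.output x)
  unfold QubitReaches
  convert h using 3 with ψ x
  simp only [state, Finset.prod_empty, one_mul]
  congr 1
  funext i
  simp only [ungroup, E, Equiv.coe_fn_mk]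
  have key : ∀ v (hv : G.loc (pos i) = v), x (G.loc (pos i)) ⟨pos i, rfl⟩ = x v ⟨pos i, hv⟩ := by
    rintro _ rfl
    rfl
  exact key _ _

end Network

/-! ### A criterion for implementability -/

theorem trace_proj {n : Type} [Fintype n] (ψ : n → ℂ) :
    (proj ψ).trace = ((∑ x, ‖ψ x‖ ^ 2 : ℝ) : ℂ) := by
  simp [Matrix.trace, proj, Matrix.vecMulVec_apply, Complex.mul_conj']

theorem trace_proj_comp {m n : Type} [Fintype m] [Fintype n] {e : m → n}
    (he : Function.Bijective e) (ψ : n → ℂ) :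
    (proj fun x => ψ (e x)).trace = (proj ψ).trace := by
  rw [trace_proj, trace_proj]
  congr 1
  exact he.sum_comp fun x => ‖ψ x‖ ^ 2

theorem trace_proj_mulVec {n : Type} [Fintype n] [DecidableEq n] {U : Matrix n n ℂ}
    (hU : U ∈ Matrix.unitaryGroup n ℂ) (ψ : n → ℂ) : (proj (U *ᵥ ψ)).trace = (proj ψ).trace := by
  rw [← mul_proj_mul, Matrix.trace_mul_comm, ← Matrix.mul_assoc,
    show Uᴴ * U = 1 from Matrix.mem_unitaryGroup_iff'.1 hU, Matrix.one_mul]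

namespace Network

variable {V : Type} {k : ℕ} (G : Network V k)

/-- The sum factors into the inputs and the edges, and each EPR pair contributes 1/2 + 1/2. -/
theorem sum_norm_initialState [DecidableEq V] (ψ : (Fin k → Fin 2) → ℂ) :
    ∑ x, ‖G.initialState ψ x‖ ^ 2 = ∑ y, ‖ψ y‖ ^ 2 := by
  have hterm : ∀ x, ‖G.initialState ψ x‖ ^ 2 = ‖ψ fun i => x (.inl i)‖ ^ 2 *
      ∏ e : G.edges, if x (.inr (e, 0)) = x (.inr (e, 1)) then (1 / 2 : ℝ) else 0 := by
    intro x
    rw [initialState, norm_mul, mul_pow, norm_prod, ← Finset.prod_pow]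
    congr 1
    refine Finset.prod_congr rfl fun e _ => ?_
    split_ifs
    · rw [Complex.norm_real, Real.norm_eq_abs, sq_abs, div_pow, Real.sq_sqrt (by norm_num), one_pow]
    · simp
  have hsum : ∀ (F : (Fin k → Fin 2) → ℝ) (K : (G.edges × Fin 2 → Fin 2) → ℝ),
      ∑ x : G.Qubit → Fin 2, F (fun i => x (.inl i)) * K (fun q => x (.inr q)) =
        (∑ y, F y) * ∑ z, K z := by
    intro F K
    rw [Finset.sum_mul_sum, ← Fintype.sum_prod_type' (fun y z => F y * K z)]
    exact (Equiv.sumArrowEquivProdArrow _ _ _).sum_comp (fun p => F p.1 * K p.2)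
  have hpairs : ∑ z : G.edges × Fin 2 → Fin 2,
      ∏ e : G.edges, (if z (e, 0) = z (e, 1) then (1 / 2 : ℝ) else 0) = 1 := by
    rw [← (Equiv.curry G.edges (Fin 2) (Fin 2)).symm.sum_comp]
    have h := Finset.prod_univ_sum (fun _ : G.edges => (Finset.univ : Finset (Fin 2 → Fin 2)))
      (fun _ w => if w 0 = w 1 then (1 / 2 : ℝ) else 0)
    rw [Fintype.piFinset_univ] at h
    refine h.symm.trans (Finset.prod_eq_one fun e _ => ?_)
    rw [← (finTwoArrowEquiv (Fin 2)).symm.sum_comp, Fintype.sum_prod_type]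
    simp
  simp only [hterm]
  rw [hsum (fun y => ‖ψ y‖ ^ 2)
    (fun z => ∏ e : G.edges, if z (e, 0) = z (e, 1) then (1 / 2 : ℝ) else 0), hpairs, mul_one]

/-- The initial projector and the target projector have the same trace, and LOCC maps preserve the
trace, so the unspecified factor must be 1. -/
theorem implements_of_reaches [Fintype V] [DecidableEq V]
    {U : Matrix (Fin k → Fin 2) (Fin k → Fin 2) ℂ}
    (hU : U ∈ Matrix.unitaryGroup (Fin k → Fin 2) ℂ)
    (h : QubitReaches G.loc (state G Finset.univ Sum.inl fun ψ => ψ)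
      fun ψ x => (U *ᵥ ψ) (ungroup G.output x)) : G.Implements U := by
  obtain ⟨Γ, hΓ, r, hr⟩ := h.smul (((1 / √2 : ℝ) : ℂ) ^ Fintype.card G.edges)
  have hstate : ∀ ψ x, ((1 / √2 : ℝ) : ℂ) ^ Fintype.card G.edges *
      state G Finset.univ Sum.inl (fun ψ => ψ) ψ x = G.initialState ψ x := by
    intro ψ x
    rw [state, initialState, ← mul_assoc, mul_comm (ψ _), ← Finset.card_univ, ← Finset.prod_const,
      ← Finset.prod_mul_distrib]
    simp only [mul_ite, mul_one, mul_zero]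
  simp only [hstate] at hr
  have htrace : ∀ ψ : (Fin k → Fin 2) → ℂ, r * (proj ψ).trace = (proj ψ).trace := by
    intro ψ
    have h₁ := congrArg
      (fun M : Matrix (∀ v, NodeBits G.output v) (∀ v, NodeBits G.output v) ℂ => M.trace) (hr ψ)
    rw [hΓ.trace_eq, Matrix.trace_smul, trace_proj_comp (ungroup_bijective G.loc) (G.initialState ψ),
      trace_proj_comp (ungroup_bijective G.output) (U *ᵥ ψ), trace_proj_mulVec hU, trace_proj,
      sum_norm_initialState, ← trace_proj, smul_eq_mul] at h₁
    exact h₁.symm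
  refine ⟨Γ, hΓ, fun ψ hψ => ?_⟩
  have h₁ : r = 1 := by
    have h₂ := htrace ψ
    rwa [trace_proj, hψ, Complex.ofReal_one, mul_one] at h₂
  have h₂ := hr ψ
  rw [h₁, one_smul] at h₂
  rw [mul_proj_mul]
  exact h₂

end Network

/-! ### Two-qubit operators in the magic basis -/

theorem sum_bits {M : Type} [AddCommMonoid M] (f : (Fin 2 → Fin 2) → M) :
    ∑ x, f x = f ![0, 0] + f ![0, 1] + (f ![1, 0] + f ![1, 1]) := by
  rw [← (finTwoArrowEquiv (Fin 2)).symm.sum_comp, Fintype.sum_prod_type]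
  simp [Fin.sum_univ_two]

theorem bits_eq (x : Fin 2 → Fin 2) : x = ![x 0, x 1] := by
  funext i
  fin_cases i <;> rfl

/-- `A ⊗ B` on two qubits. -/
def localOp (A B : Matrix (Fin 2) (Fin 2) ℂ) : Matrix (Fin 2 → Fin 2) (Fin 2 → Fin 2) ℂ :=
  Matrix.of fun x y => A (x 0) (y 0) * B (x 1) (y 1)

theorem localOp_mul (A B C D : Matrix (Fin 2) (Fin 2) ℂ) :
    localOp A B * localOp C D = localOp (A * C) (B * D) := by
  ext x y
  simp [localOp, Matrix.mul_apply, sum_bits, Fin.sum_univ_two]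
  ring

theorem conjTranspose_localOp (A B : Matrix (Fin 2) (Fin 2) ℂ) :
    (localOp A B)ᴴ = localOp Aᴴ Bᴴ := by
  ext x y
  simp [localOp, Matrix.conjTranspose_apply]

theorem localOp_one : localOp 1 1 = 1 := by
  ext x y
  rw [bits_eq x, bits_eq y]
  generalize x 0 = a; generalize x 1 = b; generalize y 0 = c; generalize y 1 = d
  simp only [localOp, Matrix.of_apply, Matrix.one_apply, Matrix.cons_val_zero, Matrix.cons_val_one]
  revert a b c d
  simp [Fin.forall_fin_two]

theorem onQubit_mul_onQubit (A B : Matrix (Fin 2) (Fin 2) ℂ) :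
    onQubit 0 A * onQubit 1 B = localOp A B := by
  ext x y
  rw [bits_eq x, bits_eq y]
  generalize x 0 = a; generalize x 1 = b; generalize y 0 = c; generalize y 1 = d
  simp only [localOp, onQubit, Matrix.of_apply, Matrix.mul_apply, sum_bits, Fin.forall_fin_two]
  revert a b c d
  simp [Fin.forall_fin_two]

/-- The matrix of a quaternion, or rather of its coefficients with respect to
`1, iZ, iX, iY`. -/
def quatMatrix (u : Fin 4 → ℂ) : Matrix (Fin 2) (Fin 2) ℂ :=
  !![u 0 + Complex.I * u 1, u 3 + Complex.I * u 2; -u 3 + Complex.I * u 2, u 0 - Complex.I * u 1]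

/-- The change of basis from the magic basis of two qubits to the computational one. -/
noncomputable def magic : Matrix (Fin 2 → Fin 2) (Fin 4) ℂ :=
  Matrix.of fun x j => ((1 / √2 : ℝ) : ℂ) * quatMatrix (Pi.single j 1) (x 0) (x 1)

theorem magic_conjTranspose_mul_self : magicᴴ * magic = 1 := by
  have h := inv_sqrt_two_mul_self
  have hs : star ((1 / √2 : ℝ) : ℂ) = ((1 / √2 : ℝ) : ℂ) := Complex.conj_ofReal _
  ext i j
  simp only [Matrix.mul_apply, Matrix.conjTranspose_apply, magic, Matrix.of_apply, sum_bits,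
    quatMatrix, star_mul', hs]
  generalize ((1 / √2 : ℝ) : ℂ) = r at h
  have hI := Complex.I_mul_I
  fin_cases i <;> fin_cases j <;> simp
  all_goals first
    | ring1
    | linear_combination 2 * h
    | linear_combination 2 * h - 2 * r * r * hI

theorem magic_mul_conjTranspose_self : magic * magicᴴ = 1 :=
  (Matrix.mul_eq_one_comm_of_card_eq _ _ _ (by simp)).1 magic_conjTranspose_mul_self

theorem quatMatrix_mem_unitaryGroup {u : Fin 4 → ℝ} (hu : ∑ i, u i ^ 2 = 1) :
    quatMatrix (fun i => u i) ∈ Matrix.unitaryGroup (Fin 2) ℂ := by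
  rw [Matrix.mem_unitaryGroup_iff, Matrix.star_eq_conjTranspose]
  have hu' : (u 0 : ℂ) ^ 2 + (u 1 : ℂ) ^ 2 + (u 2 : ℂ) ^ 2 + (u 3 : ℂ) ^ 2 = 1 := by
    rw [Fin.sum_univ_four] at hu
    exact_mod_cast hu
  have hI := Complex.I_mul_I
  ext i j
  simp only [Matrix.mul_apply, Matrix.conjTranspose_apply, Fin.sum_univ_two, quatMatrix]
  fin_cases i <;> fin_cases j <;> simp
  all_goals generalize (u 0 : ℂ) = u₀ at *; generalize (u 1 : ℂ) = u₁ at *; generalize (u 2 : ℂ) = u₂ at *; generalize (u 3 : ℂ) = u₃ at *; generalize Complex.I = i at *; clear hu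
  all_goals grind

/-- The reflection in the hyperplane orthogonal to the unit vector `u`. -/
def householder (u : Fin 4 → ℝ) : Matrix (Fin 4) (Fin 4) ℝ :=
  Matrix.of fun i j => (if i = j then 1 else 0) - 2 * u i * u j

/-- For a unit quaternion u the two reflections are q ↦ -u q̄ u and q ↦ -q̄, so their product is q ↦
u q u. On two qubits A⊗B sends the coefficient matrix M to A M Bᵀ, whence the transpose in the
second factor. -/
theorem magic_mul_householder {u : Fin 4 → ℝ} (hu : ∑ i, u i ^ 2 = 1) :
    magic * ((householder u).map Complex.ofReal * (householder (Pi.single 0 1)).map Complex.ofReal) =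
      localOp (quatMatrix fun i => u i) (quatMatrix fun i => u i)ᵀ * magic := by
  have hu' : (u 0 : ℂ) ^ 2 + (u 1 : ℂ) ^ 2 + (u 2 : ℂ) ^ 2 + (u 3 : ℂ) ^ 2 = 1 := by
    rw [Fin.sum_univ_four] at hu
    exact_mod_cast hu
  have hI := Complex.I_mul_I
  ext x j
  rw [bits_eq x]
  generalize x 0 = a; generalize x 1 = b
  simp only [Matrix.mul_apply, magic, Matrix.of_apply, sum_bits, Fin.sum_univ_four, householder,
    localOp, Matrix.map_apply, quatMatrix, Matrix.transpose_apply]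
  generalize ((1 / √2 : ℝ) : ℂ) = r
  fin_cases a <;> fin_cases b <;> fin_cases j <;> simp
  all_goals generalize (u 0 : ℂ) = u₀ at *; generalize (u 1 : ℂ) = u₁ at *; generalize (u 2 : ℂ) = u₂ at *; generalize (u 3 : ℂ) = u₃ at *; generalize Complex.I = i at *; clear hu
  all_goals grind

/-! ### Real orthogonal matrices are local in the magic basis -/

/-- The two-qubit operators `A ⊗ B` with unitary `A` and `B`. -/
def IsLocalUnitary (W : Matrix (Fin 2 → Fin 2) (Fin 2 → Fin 2) ℂ) : Prop :=
  ∃ A ∈ Matrix.unitaryGroup (Fin 2) ℂ, ∃ B ∈ Matrix.unitaryGroup (Fin 2) ℂ, W = localOp A B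

theorem IsLocalUnitary.one : IsLocalUnitary 1 :=
  ⟨1, one_mem _, 1, one_mem _, localOp_one.symm⟩

theorem IsLocalUnitary.mul {W W' : Matrix (Fin 2 → Fin 2) (Fin 2 → Fin 2) ℂ}
    (h : IsLocalUnitary W) (h' : IsLocalUnitary W') : IsLocalUnitary (W * W') := by
  obtain ⟨A, hA, B, hB, rfl⟩ := h
  obtain ⟨C, hC, D, hD, rfl⟩ := h'
  exact ⟨A * C, mul_mem hA hC, B * D, mul_mem hB hD, localOp_mul A B C D⟩

theorem IsLocalUnitary.conjTranspose {W : Matrix (Fin 2 → Fin 2) (Fin 2 → Fin 2) ℂ}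
    (h : IsLocalUnitary W) : IsLocalUnitary Wᴴ := by
  obtain ⟨A, hA, B, hB, rfl⟩ := h
  exact ⟨star A, Unitary.star_mem hA, star B, Unitary.star_mem hB, conjTranspose_localOp A B⟩

/-- A real operator in the magic basis. -/
noncomputable def fromMagic (O : Matrix (Fin 4) (Fin 4) ℝ) :
    Matrix (Fin 2 → Fin 2) (Fin 2 → Fin 2) ℂ :=
  magic * O.map Complex.ofReal * magicᴴ

theorem fromMagic_mul (O O' : Matrix (Fin 4) (Fin 4) ℝ) :
    fromMagic (O * O') = fromMagic O * fromMagic O' := by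
  have h : (O * O').map Complex.ofReal = O.map Complex.ofReal * O'.map Complex.ofReal :=
    Matrix.map_mul (f := Complex.ofRealHom)
  calc fromMagic (O * O') = magic * O.map Complex.ofReal *
        (1 : Matrix (Fin 4) (Fin 4) ℂ) * O'.map Complex.ofReal * magicᴴ := by
        rw [fromMagic, h, Matrix.mul_one, ← Matrix.mul_assoc]
    _ = fromMagic O * fromMagic O' := by
        rw [← magic_conjTranspose_mul_self]
        simp only [fromMagic, Matrix.mul_assoc]

theorem fromMagic_one : fromMagic 1 = 1 := by
  rw [fromMagic, Matrix.map_one _ Complex.ofReal_zero Complex.ofReal_one, Matrix.mul_one,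
    magic_mul_conjTranspose_self]

theorem conjTranspose_fromMagic (O : Matrix (Fin 4) (Fin 4) ℝ) :
    (fromMagic O)ᴴ = fromMagic Oᵀ := by
  have h : (O.map Complex.ofReal)ᴴ = Oᵀ.map Complex.ofReal := by
    ext i j
    simp [Matrix.conjTranspose_apply]
  rw [fromMagic, Matrix.conjTranspose_mul, Matrix.conjTranspose_mul, h,
    Matrix.conjTranspose_conjTranspose, ← Matrix.mul_assoc, fromMagic]

/-- The reflection in the first basis vector of the magic basis. -/
noncomputable def baseReflection : Matrix (Fin 4) (Fin 4) ℝ := householder (Pi.single 0 1)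

theorem baseReflection_eq : baseReflection = Matrix.diagonal ![-1, 1, 1, 1] := by
  ext i j
  fin_cases i <;> fin_cases j <;>
    (simp [baseReflection, householder]; try norm_num)

theorem baseReflection_mul_self : baseReflection * baseReflection = 1 := by
  rw [baseReflection_eq, Matrix.diagonal_mul_diagonal, ← Matrix.diagonal_one]
  congr 1
  funext i
  fin_cases i <;> simp

theorem transpose_baseReflection : baseReflectionᵀ = baseReflection := by
  rw [baseReflection_eq, Matrix.diagonal_transpose]

theorem transpose_mem_unitaryGroup {A : Matrix (Fin 2) (Fin 2) ℂ}
    (hA : A ∈ Matrix.unitaryGroup (Fin 2) ℂ) : Aᵀ ∈ Matrix.unitaryGroup (Fin 2) ℂ := by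
  rw [Matrix.mem_unitaryGroup_iff, Matrix.star_eq_conjTranspose]
  have h := congrArg Matrix.transpose (Matrix.mem_unitaryGroup_iff'.1 hA)
  rwa [Matrix.transpose_mul, Matrix.transpose_one] at h

theorem isLocalUnitary_householder_mul {u : Fin 4 → ℝ} (hu : ∑ i, u i ^ 2 = 1) :
    IsLocalUnitary (fromMagic (householder u * baseReflection)) := by
  refine ⟨_, quatMatrix_mem_unitaryGroup hu, _,
    transpose_mem_unitaryGroup (quatMatrix_mem_unitaryGroup hu), ?_⟩
  have h : (householder u * baseReflection).map Complex.ofReal =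
      (householder u).map Complex.ofReal * baseReflection.map Complex.ofReal :=
    Matrix.map_mul (f := Complex.ofRealHom)
  rw [fromMagic, h, baseReflection, magic_mul_householder hu, Matrix.mul_assoc,
    magic_mul_conjTranspose_self, Matrix.mul_one]

theorem transpose_householder (u : Fin 4 → ℝ) : (householder u)ᵀ = householder u := by
  ext i j
  simp only [householder, Matrix.transpose_apply, Matrix.of_apply, @eq_comm _ j i]
  ring

theorem isLocalUnitary_mul_householder {u : Fin 4 → ℝ} (hu : ∑ i, u i ^ 2 = 1) :
    IsLocalUnitary (fromMagic (baseReflection * householder u)) := by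
  have h := (isLocalUnitary_householder_mul hu).conjTranspose
  rwa [conjTranspose_fromMagic, Matrix.transpose_mul, transpose_householder,
    transpose_baseReflection] at h

/-- Either `O` or its product with the base reflection is local. -/
def IsLocalUpToReflection (O : Matrix (Fin 4) (Fin 4) ℝ) : Prop :=
  IsLocalUnitary (fromMagic O) ∨ IsLocalUnitary (fromMagic (baseReflection * O))

/-- A product of a reflection with the base reflection is local, in either order, so one more
reflection exchanges the two alternatives. -/
theorem IsLocalUpToReflection.householder_mul {u : Fin 4 → ℝ} (hu : ∑ i, u i ^ 2 = 1)
    {O : Matrix (Fin 4) (Fin 4) ℝ} (h : IsLocalUpToReflection O) :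
    IsLocalUpToReflection (householder u * O) := by
  rcases h with h | h
  · right
    rw [← Matrix.mul_assoc, fromMagic_mul]
    exact (isLocalUnitary_mul_householder hu).mul h
  · left
    have h' := (isLocalUnitary_householder_mul hu).mul h
    rwa [← fromMagic_mul, Matrix.mul_assoc, ← Matrix.mul_assoc baseReflection,
      baseReflection_mul_self, Matrix.one_mul] at h'

/-- The matrix of a linear isometry. -/
noncomputable def isometryMatrix (φ : EuclideanSpace ℝ (Fin 4) ≃ₗᵢ[ℝ] EuclideanSpace ℝ (Fin 4)) :
    Matrix (Fin 4) (Fin 4) ℝ :=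
  (Matrix.toEuclideanCLM (n := Fin 4) (𝕜 := ℝ)).symm
    (φ : EuclideanSpace ℝ (Fin 4) →L[ℝ] EuclideanSpace ℝ (Fin 4))

theorem isometryMatrix_mul (φ φ' : EuclideanSpace ℝ (Fin 4) ≃ₗᵢ[ℝ] EuclideanSpace ℝ (Fin 4)) :
    isometryMatrix (φ * φ') = isometryMatrix φ * isometryMatrix φ' := by
  rw [isometryMatrix, isometryMatrix, isometryMatrix, ← map_mul]
  rfl

theorem isometryMatrix_one : isometryMatrix 1 = 1 := by
  rw [isometryMatrix, ← map_one (Matrix.toEuclideanCLM (n := Fin 4) (𝕜 := ℝ)).symm]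
  rfl

theorem isometryMatrix_reflection (v : EuclideanSpace ℝ (Fin 4)) :
    isometryMatrix (ℝ ∙ v)ᗮ.reflection = 1 ∨ ∃ u : Fin 4 → ℝ, ∑ i, u i ^ 2 = 1 ∧
      isometryMatrix (ℝ ∙ v)ᗮ.reflection = householder u := by
  -- The vectors supplied by the decomposition into reflections may be zero, and then the reflection
  -- is the identity.
  by_cases hv : v = 0
  · left
    rw [← isometryMatrix_one]
    congr 1
    ext1 x
    rw [Submodule.reflection_orthogonal_apply, Submodule.reflection_singleton_apply, hv]
    simp
  · right
    have hv' : ‖v‖ ≠ 0 := norm_ne_zero_iff.2 hv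
    have hnorm : ∑ i, v i ^ 2 = ‖v‖ ^ 2 := by
      rw [EuclideanSpace.real_norm_sq_eq]
    refine ⟨fun i => v i / ‖v‖, ?_, ?_⟩
    · simp only [div_pow, ← Finset.sum_div, hnorm]
      field_simp
    · rw [isometryMatrix, StarAlgEquiv.symm_apply_eq]
      ext x i
      rw [Matrix.ofLp_toEuclideanCLM]
      change (ℝ ∙ v)ᗮ.reflection x i = _
      rw [Submodule.reflection_orthogonal_apply, Submodule.reflection_singleton_apply]
      simp only [householder, Matrix.mulVec, dotProduct, Matrix.of_apply, sub_mul, ite_mul, one_mul,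
        zero_mul, Finset.sum_sub_distrib, Finset.sum_ite_eq, Finset.mem_univ, if_true,
        PiLp.inner_apply]
      simp [Finset.sum_div, Finset.mul_sum, Finset.sum_mul]
      refine Finset.sum_congr rfl fun j _ => ?_
      field_simp

/-- By Cartan–Dieudonné `O` is a product of reflections, which are absorbed one at a time. -/
theorem isLocalUpToReflection_of_orthogonal {O : Matrix (Fin 4) (Fin 4) ℝ}
    (hO : Oᵀ * O = 1) : IsLocalUpToReflection O := by
  have hO' : O ∈ unitary (Matrix (Fin 4) (Fin 4) ℝ) :=
    Matrix.mem_unitaryGroup_iff'.2 hO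
  have hT : Matrix.toEuclideanCLM (n := Fin 4) (𝕜 := ℝ) O ∈
      unitary (EuclideanSpace ℝ (Fin 4) →L[ℝ] EuclideanSpace ℝ (Fin 4)) :=
    Unitary.map_mem _ hO'
  obtain ⟨l, -, hl⟩ :=
    (Unitary.linearIsometryEquiv ⟨_, hT⟩).reflections_generate_dim
  have hmat : O = isometryMatrix (Unitary.linearIsometryEquiv ⟨_, hT⟩) := by
    rw [isometryMatrix, Unitary.coe_linearIsometryEquiv_apply, StarAlgEquiv.symm_apply_apply]
  rw [hmat, hl]
  clear hl hmat
  induction l with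
  | nil =>
    rw [List.map_nil, List.prod_nil, isometryMatrix_one]
    left
    rw [fromMagic_one]
    exact .one
  | cons v l ih =>
    rw [List.map_cons, List.prod_cons, isometryMatrix_mul]
    rcases isometryMatrix_reflection v with h | ⟨u, hu, h⟩
    · rwa [h, Matrix.one_mul]
    · rw [h]
      exact ih.householder_mul hu

/-! ### The Cartan decomposition of two-qubit unitaries -/

/-! ### Real orthogonal diagonalisation of symmetric unitary matrices -/

section SymmetricUnitary

variable {n : Type} [Fintype n] [DecidableEq n]

/-- The polynomial det(1 - XS) takes the value 1 at 0, so it cannot vanish on the whole unit circle,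
which is infinite. The rotation by `ω` makes the Cayley transform available. -/
theorem exists_isUnit_one_sub_smul (S : Matrix n n ℂ) :
    ∃ ω : ℂ, ‖ω‖ = 1 ∧ IsUnit (1 - ω • S) := by
  by_contra! h
  have hinf : (Metric.sphere (0 : ℂ) 1).Infinite :=
    (isPreconnected_sphere (by rw [Complex.rank_real_complex]; norm_num) 0 1).infinite_of_nontrivial
      ⟨1, by simp, -1, by simp, by norm_num⟩
  have hzero : S.charpolyRev = 0 := by
    refine Polynomial.eq_zero_of_infinite_isRoot _ (hinf.mono fun ω hω => ?_)
    have hω' := h ω (by simpa using hω)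
    rw [Matrix.isUnit_iff_isUnit_det, isUnit_iff_ne_zero, not_not] at hω'
    rw [Set.mem_ofPred_eq, Polynomial.IsRoot, Matrix.charpolyRev, ← Polynomial.coe_evalRingHom,
      RingHom.map_det, ← hω']
    congr 1
    ext i j
    simp [Matrix.one_apply, apply_ite]
    exact mul_comm _ _
  have := S.eval_charpolyRev
  simp [hzero] at this

theorem exists_orthogonal_diagonalization_real {A : Matrix n n ℝ} (hA : Aᵀ = A) :
    ∃ P : Matrix n n ℝ, Pᵀ * P = 1 ∧ ∃ a : n → ℝ, A = P * Matrix.diagonal a * Pᵀ := by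
  have hA' : A.IsHermitian := hA
  refine ⟨hA'.eigenvectorUnitary, Matrix.mem_unitaryGroup_iff'.1 hA'.eigenvectorUnitary.2,
    hA'.eigenvalues, ?_⟩
  have h := hA'.spectral_theorem
  rw [Unitary.conjStarAlgAut_apply] at h
  exact h

/-- A symmetric unitary matrix is diagonalised by a real orthogonal matrix. -/
theorem exists_orthogonal_diagonalization {S : Matrix n n ℂ} (hsymm : Sᵀ = S) (hS : Sᴴ * S = 1) :
    ∃ P : Matrix n n ℝ, Pᵀ * P = 1 ∧ ∃ d : n → ℂ, (∀ i, ‖d i‖ = 1) ∧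
      S = P.map Complex.ofReal * Matrix.diagonal d * Pᵀ.map Complex.ofReal := by
  obtain ⟨ω, hω, hunit⟩ := exists_isUnit_one_sub_smul S
  have hω₀ : ω ≠ 0 := norm_ne_zero_iff.1 (by rw [hω]; exact one_ne_zero)
  set N := ω • S with hN
  have hNt : Nᵀ = N := by rw [hN, Matrix.transpose_smul, hsymm]
  have hNN : Nᴴ * N = 1 := by
    rw [hN, Matrix.conjTranspose_smul, Matrix.smul_mul, Matrix.mul_smul, hS, smul_smul,
      RCLike.star_def, RCLike.conj_mul, hω]
    simp
  obtain ⟨E, hE, hE'⟩ := isUnit_iff_exists.1 hunit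
  -- The Cayley transform i(1+N)(1-N)⁻¹ of a symmetric unitary `N` is symmetric and Hermitian, hence
  -- real symmetric, and the real spectral theorem applies to it.
  obtain ⟨K, hK⟩ : ∃ K, K = Complex.I • ((1 + N) * E) := ⟨_, rfl⟩
  have hKD : K * (1 - N) = Complex.I • (1 + N) := by
    rw [hK, Matrix.smul_mul, Matrix.mul_assoc, hE', Matrix.mul_one]
  have hcancel : ∀ X Y : Matrix n n ℂ, (1 - N) * X * (1 - N) = (1 - N) * Y * (1 - N) → X = Y :=
    fun X Y h => hunit.mul_left_cancel (hunit.mul_right_cancel h)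
  have hKt : Kᵀ = K := by
    refine hcancel _ _ ?_
    have h₁ : (1 - N) * Kᵀ = Complex.I • (1 + N) := by
      have h := congrArg Matrix.transpose hKD
      simpa only [Matrix.transpose_mul, Matrix.transpose_smul, Matrix.transpose_sub,
        Matrix.transpose_add, Matrix.transpose_one, hNt] using h
    rw [h₁, Matrix.mul_assoc, hKD, Matrix.smul_mul, Matrix.mul_smul]
    congr 1
    noncomm_ring
  have hKh : Kᴴ = K := by
    have hunit' : IsUnit (1 - Nᴴ) := by
      have h := hunit.star
      rwa [Matrix.star_eq_conjTranspose, Matrix.conjTranspose_sub, Matrix.conjTranspose_one] at h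
    refine hunit'.mul_left_cancel (hunit.mul_right_cancel ?_)
    have h₁ : (1 - Nᴴ) * Kᴴ = -(Complex.I • (1 + Nᴴ)) := by
      have h := congrArg Matrix.conjTranspose hKD
      rw [Matrix.conjTranspose_mul, Matrix.conjTranspose_smul, Matrix.conjTranspose_sub,
        Matrix.conjTranspose_add, Matrix.conjTranspose_one] at h
      rw [h, RCLike.star_def, Complex.conj_I, neg_smul]
    rw [h₁, Matrix.mul_assoc, hKD, neg_mul, Matrix.smul_mul, Matrix.mul_smul, ← smul_neg]
    congr 1
    have : -((1 + Nᴴ) * (1 - N)) = Nᴴ * N - 1 + N - Nᴴ := by noncomm_ring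
    rw [this, hNN]
    have : (1 - Nᴴ) * (1 + N) = 1 - Nᴴ * N + N - Nᴴ := by noncomm_ring
    rw [this, hNN]
  have hreal : ∀ i j, ((K i j).re : ℂ) = K i j := by
    intro i j
    rw [← Complex.conj_eq_iff_re]
    calc star (K i j) = Kᴴ j i := rfl
      _ = Kᵀ i j := by rw [hKh]; rfl
      _ = K i j := by rw [hKt]
  set A : Matrix n n ℝ := K.map Complex.re with hA
  have hAK : A.map Complex.ofReal = K := by
    ext i j
    exact hreal i j
  have hAt : Aᵀ = A := by
    rw [hA, ← Matrix.transpose_map, hKt]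
  obtain ⟨P, hP, a, ha⟩ := exists_orthogonal_diagonalization_real hAt
  have hmap : ∀ X Y : Matrix n n ℝ, (X * Y).map Complex.ofReal =
      X.map Complex.ofReal * Y.map Complex.ofReal := fun X Y =>
    Matrix.map_mul (f := Complex.ofRealHom)
  have hmap₁ : (1 : Matrix n n ℝ).map Complex.ofReal = 1 :=
    Matrix.map_one _ Complex.ofReal_zero Complex.ofReal_one
  set Q := P.map Complex.ofReal
  set R := Pᵀ.map Complex.ofReal
  have hRQ : R * Q = 1 := by rw [← hmap, hP, hmap₁]
  have hQR : Q * R = 1 := by rw [← hmap, mul_eq_one_comm.1 hP, hmap₁]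
  have hKd : K = Q * Matrix.diagonal (fun i => (a i : ℂ)) * R := by
    rw [← hAK, ha, hmap, hmap]
    rw [Matrix.diagonal_map Complex.ofReal_zero]
  have hne : ∀ i, (a i : ℂ) + Complex.I ≠ 0 := by
    intro i h
    have := congrArg Complex.im h
    simp at this
  -- Inverting the Cayley transform gives N = (K+i)⁻¹(K-i), and `ω⁻¹` undoes the rotation of `S`.
  refine ⟨P, hP, fun i => ω⁻¹ * (((a i : ℂ) - Complex.I) / ((a i : ℂ) + Complex.I)), ?_, ?_⟩
  · intro i
    rw [norm_mul, norm_inv, hω, norm_div, inv_one, one_mul]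
    have : ((a i : ℂ) - Complex.I) = star ((a i : ℂ) + Complex.I) := by simp [sub_eq_add_neg]
    rw [this, norm_star, div_self]
    exact norm_ne_zero_iff.2 (hne i)
  · have h₁ : K - Complex.I • (1 : Matrix n n ℂ) = (K + Complex.I • (1 : Matrix n n ℂ)) * N := by
      have h := hKD
      rw [mul_sub, mul_one, smul_add] at h
      rw [sub_eq_iff_eq_add] at h ⊢
      rw [add_mul, Matrix.smul_mul, Matrix.one_mul]
      exact h.trans (by abel)
    have hI : ∀ c : ℂ, c • (1 : Matrix n n ℂ) = Q * Matrix.diagonal (fun _ => c) * R := by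
      intro c
      rw [← Matrix.smul_one_eq_diagonal, Matrix.mul_smul, Matrix.smul_mul, Matrix.mul_one, hQR]
    have h₂ : N = Q * Matrix.diagonal
        (fun i => ((a i : ℂ) - Complex.I) / ((a i : ℂ) + Complex.I)) * R := by
      rw [hKd, hI, ← sub_mul, ← mul_sub, ← add_mul, ← mul_add, Matrix.diagonal_sub,
        Matrix.diagonal_add] at h₁
      have h₃ := congrArg (fun X => Q * Matrix.diagonal (fun i => ((a i : ℂ) + Complex.I)⁻¹) *
        (R * X)) h₁
      have hdiag : Matrix.diagonal (fun i => ((a i : ℂ) + Complex.I)⁻¹) *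
          Matrix.diagonal (fun i => (a i : ℂ) + Complex.I) = 1 := by
        rw [Matrix.diagonal_mul_diagonal, ← Matrix.diagonal_one]
        congr 1
        funext i
        exact inv_mul_cancel₀ (hne i)
      have hl : Q * Matrix.diagonal (fun i => ((a i : ℂ) + Complex.I)⁻¹) *
          (R * (Q * Matrix.diagonal (fun i => (a i : ℂ) + Complex.I) * R * N)) = N := by
        calc _ = Q * Matrix.diagonal (fun i => ((a i : ℂ) + Complex.I)⁻¹) * (R * Q) *
            Matrix.diagonal (fun i => (a i : ℂ) + Complex.I) * R * N := by
              simp only [Matrix.mul_assoc]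
          _ = N := by
            rw [hRQ, Matrix.mul_one, Matrix.mul_assoc Q, hdiag, Matrix.mul_one, hQR, Matrix.one_mul]
      have hr : Q * Matrix.diagonal (fun i => ((a i : ℂ) + Complex.I)⁻¹) *
          (R * (Q * Matrix.diagonal (fun i => (a i : ℂ) - Complex.I) * R)) =
          Q * Matrix.diagonal
            (fun i => ((a i : ℂ) - Complex.I) / ((a i : ℂ) + Complex.I)) * R := by
        calc _ = Q * Matrix.diagonal (fun i => ((a i : ℂ) + Complex.I)⁻¹) * (R * Q) *
            Matrix.diagonal (fun i => (a i : ℂ) - Complex.I) * R := by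
              simp only [Matrix.mul_assoc]
          _ = _ := by
            rw [hRQ, Matrix.mul_one, Matrix.mul_assoc Q, Matrix.diagonal_mul_diagonal]
            simp only [div_eq_inv_mul]
      exact hl.symm.trans (h₃.symm.trans hr)
    have h₃ : S = ω⁻¹ • N := by rw [hN, smul_smul, inv_mul_cancel₀ hω₀, one_smul]
    rw [h₃, h₂, ← Matrix.smul_mul, ← Matrix.mul_smul, ← Matrix.diagonal_smul]
    rfl

end SymmetricUnitary

/-! ### The canonical gate in the magic basis -/

/-- The eigenvalues of `x X⊗X + y Y⊗Y + z Z⊗Z` in the magic basis. -/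
noncomputable def magicPhase (x y z : ℝ) : Fin 4 → ℂ :=
  ![x - y + z, -x + y + z, x + y - z, -x - y - z]

/-- The columns of `magic` are the Bell states up to phases, the common eigenvectors of the three
commuting operators. -/
theorem localOp_pauli_mul_magic :
    localOp pauliX pauliX * magic = magic * Matrix.diagonal (![1, -1, 1, -1] : Fin 4 → ℂ) ∧
    localOp pauliY pauliY * magic = magic * Matrix.diagonal (![-1, 1, 1, -1] : Fin 4 → ℂ) ∧
    localOp pauliZ pauliZ * magic = magic * Matrix.diagonal (![1, 1, -1, -1] : Fin 4 → ℂ) := by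
  refine ⟨?_, ?_, ?_⟩ <;>
  · ext x j
    rw [Matrix.mul_diagonal, bits_eq x]
    generalize x 0 = a; generalize x 1 = b
    simp only [Matrix.mul_apply, sum_bits, localOp, Matrix.of_apply, magic,
      quatMatrix, pauliX, pauliY, pauliZ]
    fin_cases a <;> fin_cases b <;> fin_cases j <;> simp

theorem exp_magic (d : Fin 4 → ℂ) :
    NormedSpace.exp (magic * Matrix.diagonal d * magicᴴ) =
      magic * Matrix.diagonal (fun j => Complex.exp (d j)) * magicᴴ := by
  -- `magic` has different row and column types; reindexing makes it a unit of a matrix ring, so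
  -- that the exponential commutes with conjugation.
  let e : Fin 4 ≃ (Fin 2 → Fin 2) := Fintype.equivOfCardEq (by simp)
  let U : Matrix (Fin 2 → Fin 2) (Fin 2 → Fin 2) ℂ := magic.submatrix id e.symm
  have hU : U * Uᴴ = 1 := by
    rw [Matrix.conjTranspose_submatrix, Matrix.submatrix_mul_equiv, magic_mul_conjTranspose_self]
    rfl
  have hinv : U⁻¹ = Uᴴ := Matrix.inv_eq_right_inv hU
  have hconj : ∀ c : Fin 4 → ℂ, magic * Matrix.diagonal c * magicᴴ =
      U * Matrix.diagonal (fun x => c (e.symm x)) * U⁻¹ := by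
    intro c
    have : Matrix.diagonal (fun x => c (e.symm x)) = (Matrix.diagonal c).submatrix e.symm e.symm :=
      (Matrix.submatrix_diagonal_equiv c e.symm).symm
    rw [hinv, this, Matrix.conjTranspose_submatrix, Matrix.submatrix_mul_equiv,
      Matrix.submatrix_mul_equiv, Matrix.submatrix_id_id]
  have hunit : IsUnit U := IsUnit.of_mul_eq_one _ hU
  rw [hconj, Matrix.exp_conj _ _ hunit, hconj, Matrix.exp_diagonal]
  congr 3
  funext x
  rw [Pi.coe_exp, Complex.exp_eq_exp_ℂ]

theorem uGlobal_eq_magic (x y z : ℝ) :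
    uGlobal x y z = magic * Matrix.diagonal
      (fun j => Complex.exp (Complex.I * magicPhase x y z j)) * magicᴴ := by
  rw [← exp_magic, uGlobal]
  congr 1
  have hmagic : ∀ (P : Matrix (Fin 2) (Fin 2) ℂ) (d : Fin 4 → ℂ),
      localOp P P * magic = magic * Matrix.diagonal d →
        localOp P P = magic * Matrix.diagonal d * magicᴴ := by
    intro P d h
    rw [← h, Matrix.mul_assoc, magic_mul_conjTranspose_self, Matrix.mul_one]
  obtain ⟨hX, hY, hZ⟩ := localOp_pauli_mul_magic
  rw [onQubit_mul_onQubit, onQubit_mul_onQubit, onQubit_mul_onQubit, hmagic _ _ hX, hmagic _ _ hY,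
    hmagic _ _ hZ]
  have hd : Matrix.diagonal (fun j => Complex.I * magicPhase x y z j) =
      Complex.I • ((x : ℂ) • Matrix.diagonal (![1, -1, 1, -1] : Fin 4 → ℂ) +
        (y : ℂ) • Matrix.diagonal (![-1, 1, 1, -1] : Fin 4 → ℂ) +
        (z : ℂ) • Matrix.diagonal (![1, 1, -1, -1] : Fin 4 → ℂ)) := by
    simp only [← Matrix.diagonal_smul, Matrix.diagonal_add]
    congr 1
    funext j
    fin_cases j <;> simp [magicPhase] <;> ring
  simp only [hd, Matrix.mul_smul, Matrix.mul_add, Matrix.add_mul, Matrix.smul_mul]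

theorem exists_magicPhase (d : Fin 4 → ℂ) (hd : ∀ j, ‖d j‖ = 1) :
    ∃ (g : ℂ) (x y z : ℝ), d = fun j => g * Complex.exp (Complex.I * magicPhase x y z j) := by
  let t : Fin 4 → ℝ := fun j => (d j).arg
  have ht : ∀ j, d j = Complex.exp (Complex.I * t j) := by
    intro j
    have h := Complex.norm_mul_exp_arg_mul_I (d j)
    rw [hd j, Complex.ofReal_one, one_mul] at h
    rw [← h, mul_comm]
  -- The mean argument is the global phase. The other three values invert the system with
  -- coefficients ±1 in `magicPhase`, whose rows are orthogonal to the constant vector.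
  refine ⟨Complex.exp (Complex.I * ((t 0 + t 1 + t 2 + t 3) / 4 : ℝ)), (t 0 - t 1 + t 2 - t 3) / 4,
    (-t 0 + t 1 + t 2 - t 3) / 4, (t 0 + t 1 - t 2 - t 3) / 4, ?_⟩
  funext j
  rw [ht j, ← Complex.exp_add]
  congr 1
  fin_cases j <;> simp [magicPhase] <;> ring

/-- A two-qubit unitary is real orthogonal in the magic basis, up to a diagonal and a real
orthogonal factor. -/
theorem exists_orthogonal_mul_diagonal_mul_orthogonal {W : Matrix (Fin 4) (Fin 4) ℂ}
    (hW : Wᴴ * W = 1) : ∃ O P : Matrix (Fin 4) (Fin 4) ℝ, Oᵀ * O = 1 ∧ Pᵀ * P = 1 ∧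
      ∃ e : Fin 4 → ℂ, (∀ j, ‖e j‖ = 1) ∧
        W = O.map Complex.ofReal * Matrix.diagonal e * Pᵀ.map Complex.ofReal := by
  have hWt : Wᵀ * (Wᵀ)ᴴ = 1 := by
    have h := congrArg Matrix.transpose hW
    rwa [Matrix.transpose_mul, Matrix.transpose_one] at h
  have hS : (Wᵀ * W)ᴴ * (Wᵀ * W) = 1 := by
    rw [Matrix.conjTranspose_mul, Matrix.mul_assoc, ← Matrix.mul_assoc (Wᵀ)ᴴ, mul_eq_one_comm.1 hWt,
      Matrix.one_mul, hW]
  obtain ⟨P, hP, d, hd, hSd⟩ := exists_orthogonal_diagonalization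
    (by rw [Matrix.transpose_mul, Matrix.transpose_transpose] : (Wᵀ * W)ᵀ = Wᵀ * W) hS
  -- If W = O D Pᵀ with real orthogonal factors, then WᵀW = P D² Pᵀ; so D must consist of square
  -- roots of the eigenvalues.
  choose e he using fun j => IsAlgClosed.exists_pow_nat_eq (d j) (n := 2) two_pos
  have he₁ : ∀ j, ‖e j‖ = 1 := by
    intro j
    have h := congrArg norm (he j)
    rw [norm_pow, hd j] at h
    exact (pow_eq_one_iff_of_nonneg (norm_nonneg _) two_ne_zero).1 h
  have hmap : ∀ X Y : Matrix (Fin 4) (Fin 4) ℝ, (X * Y).map Complex.ofReal =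
      X.map Complex.ofReal * Y.map Complex.ofReal := fun X Y =>
    Matrix.map_mul (f := Complex.ofRealHom)
  have hmap₁ : (1 : Matrix (Fin 4) (Fin 4) ℝ).map Complex.ofReal = 1 :=
    Matrix.map_one _ Complex.ofReal_zero Complex.ofReal_one
  obtain ⟨Q, hQ⟩ : ∃ Q, Q = P.map Complex.ofReal := ⟨_, rfl⟩
  have hQt : Pᵀ.map Complex.ofReal = Qᵀ := by rw [hQ, Matrix.transpose_map]
  have hQh : Qᴴ = Qᵀ := by
    ext i j
    simp [hQ, Matrix.conjTranspose_apply]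
  have hQQ : Qᵀ * Q = 1 := by rw [← hQt, hQ, ← hmap, hP, hmap₁]
  have hQQ' : Q * Qᵀ = 1 := mul_eq_one_comm.1 hQQ
  have hee : Matrix.diagonal e * Matrix.diagonal (star e) = 1 := by
    rw [Matrix.diagonal_mul_diagonal, ← Matrix.diagonal_one]
    congr 1
    funext j
    rw [Pi.star_apply, RCLike.star_def, RCLike.mul_conj, he₁]
    simp
  have hee' : Matrix.diagonal (star e) * Matrix.diagonal e = 1 := mul_eq_one_comm.1 hee
  have hed : Matrix.diagonal d = Matrix.diagonal e * Matrix.diagonal e := by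
    rw [Matrix.diagonal_mul_diagonal]
    congr 1
    funext j
    rw [← he j, sq]
  rw [hQt, ← hQ] at hSd
  obtain ⟨O, hO⟩ : ∃ O, O = W * Q * Matrix.diagonal (star e) := ⟨_, rfl⟩
  have hOt : Oᵀ * O = 1 := by
    calc Oᵀ * O = Matrix.diagonal (star e) * (Qᵀ * (Wᵀ * W) * Q) * Matrix.diagonal (star e) := by
          rw [hO, Matrix.transpose_mul, Matrix.transpose_mul, Matrix.diagonal_transpose]
          simp only [Matrix.mul_assoc]
      _ = Matrix.diagonal (star e) * ((Qᵀ * Q) * Matrix.diagonal d * (Qᵀ * Q)) *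
          Matrix.diagonal (star e) := by
          rw [hSd]
          simp only [Matrix.mul_assoc]
      _ = (Matrix.diagonal (star e) * Matrix.diagonal e) *
          (Matrix.diagonal e * Matrix.diagonal (star e)) := by
          rw [hQQ, Matrix.one_mul, Matrix.mul_one, hed]
          simp only [Matrix.mul_assoc]
      _ = 1 := by rw [hee, hee', Matrix.one_mul]
  have hOh : Oᴴ * O = 1 := by
    calc Oᴴ * O = Matrix.diagonal e * (Qᵀ * (Wᴴ * W) * Q) * Matrix.diagonal (star e) := by
          rw [hO, Matrix.conjTranspose_mul, Matrix.conjTranspose_mul,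
            Matrix.diagonal_conjTranspose, star_star, hQh]
          simp only [Matrix.mul_assoc]
      _ = 1 := by rw [hW, Matrix.mul_one, hQQ, Matrix.mul_one, hee]
  -- `O` is both complex orthogonal and unitary, so its adjoint and its transpose are the same
  -- inverse, and its entries are real.
  have hOO : Oᴴ = Oᵀ := by
    have h := mul_eq_one_comm.1 hOt
    calc Oᴴ = Oᴴ * (O * Oᵀ) := by rw [h, Matrix.mul_one]
      _ = Oᵀ := by rw [← Matrix.mul_assoc, hOh, Matrix.one_mul]
  have hOr : (O.map Complex.re).map Complex.ofReal = O := by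
    ext i j
    exact Complex.conj_eq_iff_re.1 (congrFun (congrFun hOO j) i)
  refine ⟨O.map Complex.re, P, ?_, hP, e, he₁, ?_⟩
  · have h : ((O.map Complex.re)ᵀ * O.map Complex.re).map Complex.ofReal =
        (1 : Matrix (Fin 4) (Fin 4) ℝ).map Complex.ofReal := by
      rw [hmap, hmap₁, Matrix.transpose_map, hOr, hOt]
    exact Matrix.map_injective Complex.ofReal_injective h
  · rw [hOr, hQt, hO, Matrix.mul_assoc _ (Matrix.diagonal (star e)), hee', Matrix.mul_one,
      Matrix.mul_assoc, hQQ', Matrix.mul_one]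

/-- A leftover base reflection is diagonal with entries ±1 in the magic basis, so it goes into `s`.
-/
theorem exists_diagonal_mul_isLocalUnitary {O : Matrix (Fin 4) (Fin 4) ℝ} (hO : Oᵀ * O = 1) :
    ∃ (W : Matrix (Fin 2 → Fin 2) (Fin 2 → Fin 2) ℂ) (s : Fin 4 → ℂ), IsLocalUnitary W ∧
      (∀ j, ‖s j‖ = 1) ∧ O.map Complex.ofReal = Matrix.diagonal s * (magicᴴ * W * magic) := by
  have hback : ∀ X : Matrix (Fin 4) (Fin 4) ℝ, magicᴴ * fromMagic X * magic =
      X.map Complex.ofReal := by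
    intro X
    rw [fromMagic, Matrix.mul_assoc, Matrix.mul_assoc _ _ magic, magic_conjTranspose_mul_self,
      Matrix.mul_one, ← Matrix.mul_assoc, magic_conjTranspose_mul_self, Matrix.one_mul]
  rcases isLocalUpToReflection_of_orthogonal hO with h | h
  · refine ⟨_, fun _ => 1, h, by simp, ?_⟩
    rw [hback, Matrix.diagonal_one, Matrix.one_mul]
  · refine ⟨_, fun j => (![-1, 1, 1, 1] : Fin 4 → ℝ) j, h, fun j => by fin_cases j <;> simp, ?_⟩
    have hmap : ∀ X Y : Matrix (Fin 4) (Fin 4) ℝ, (X * Y).map Complex.ofReal =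
        X.map Complex.ofReal * Y.map Complex.ofReal := fun X Y =>
      Matrix.map_mul (f := Complex.ofRealHom)
    have hR : Matrix.diagonal (fun j => ((![-1, 1, 1, 1] : Fin 4 → ℝ) j : ℂ)) =
        baseReflection.map Complex.ofReal := by
      rw [baseReflection_eq, Matrix.diagonal_map Complex.ofReal_zero]
    rw [hback, hR, ← hmap, ← Matrix.mul_assoc, baseReflection_mul_self, Matrix.one_mul]

theorem exists_isLocalUnitary_mul_diagonal {O : Matrix (Fin 4) (Fin 4) ℝ} (hO : Oᵀ * O = 1) :
    ∃ (W : Matrix (Fin 2 → Fin 2) (Fin 2 → Fin 2) ℂ) (s : Fin 4 → ℂ), IsLocalUnitary W ∧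
      (∀ j, ‖s j‖ = 1) ∧ O.map Complex.ofReal = magicᴴ * W * magic * Matrix.diagonal s := by
  have hO' : (Oᵀ)ᵀ * Oᵀ = 1 := by rw [Matrix.transpose_transpose, mul_eq_one_comm.1 hO]
  obtain ⟨W, s, hW, hs, h⟩ := exists_diagonal_mul_isLocalUnitary hO'
  refine ⟨Wᴴ, star s, hW.conjTranspose, fun j => by rw [Pi.star_apply, norm_star, hs], ?_⟩
  have h₁ := congrArg Matrix.conjTranspose h
  have h₂ : (Oᵀ.map Complex.ofReal)ᴴ = O.map Complex.ofReal := by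
    ext i j
    simp [Matrix.conjTranspose_apply]
  rw [h₂, Matrix.conjTranspose_mul, Matrix.diagonal_conjTranspose, Matrix.conjTranspose_mul,
    Matrix.conjTranspose_mul, Matrix.conjTranspose_conjTranspose, ← Matrix.mul_assoc] at h₁
  exact h₁

/-- The Cartan decomposition of a two-qubit unitary. -/
theorem exists_cartan_decomposition {U : Matrix (Fin 2 → Fin 2) (Fin 2 → Fin 2) ℂ}
    (hU : U ∈ Matrix.unitaryGroup (Fin 2 → Fin 2) ℂ) :
    ∃ A ∈ Matrix.unitaryGroup (Fin 2) ℂ, ∃ B ∈ Matrix.unitaryGroup (Fin 2) ℂ,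
      ∃ C ∈ Matrix.unitaryGroup (Fin 2) ℂ, ∃ D ∈ Matrix.unitaryGroup (Fin 2) ℂ,
        ∃ (g : ℂ) (x y z : ℝ), U = g • (localOp A B * uGlobal x y z * localOp C D) := by
  have hW : (magicᴴ * U * magic)ᴴ * (magicᴴ * U * magic) = 1 := by
    have hU' : Uᴴ * U = 1 := Matrix.mem_unitaryGroup_iff'.1 hU
    calc _ = magicᴴ * Uᴴ * (magic * magicᴴ) * U * magic := by
          simp only [Matrix.conjTranspose_mul, Matrix.conjTranspose_conjTranspose, Matrix.mul_assoc]
      _ = magicᴴ * (Uᴴ * U) * magic := by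
          rw [magic_mul_conjTranspose_self, Matrix.mul_one, Matrix.mul_assoc magicᴴ]
      _ = 1 := by rw [hU', Matrix.mul_one, magic_conjTranspose_mul_self]
  obtain ⟨O, P, hO, hP, e, he, hWe⟩ := exists_orthogonal_mul_diagonal_mul_orthogonal hW
  have hPP : (Pᵀ)ᵀ * Pᵀ = 1 := by rw [Matrix.transpose_transpose, mul_eq_one_comm.1 hP]
  obtain ⟨_, s, ⟨A, hA, B, hB, rfl⟩, hs, hOs⟩ := exists_isLocalUnitary_mul_diagonal hO
  obtain ⟨_, t, ⟨C, hC, D, hD, rfl⟩, ht, hPt⟩ := exists_diagonal_mul_isLocalUnitary hPP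
  -- The sign matrices of both orthogonal factors stand next to the diagonal factor, and the three
  -- merge into one diagonal of phases.
  obtain ⟨g, x, y, z, hd⟩ := exists_magicPhase (fun j => s j * (e j * t j))
    (fun j => by rw [norm_mul, norm_mul, hs, he, ht, one_mul, one_mul])
  refine ⟨A, hA, B, hB, C, hC, D, hD, g, x, y, z, ?_⟩
  have hdiag : Matrix.diagonal s * (Matrix.diagonal e * Matrix.diagonal t) = g • Matrix.diagonal
      (fun j => Complex.exp (Complex.I * magicPhase x y z j)) := by
    rw [Matrix.diagonal_mul_diagonal, Matrix.diagonal_mul_diagonal, hd, ← Matrix.diagonal_smul]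
    rfl
  calc U = (magic * magicᴴ) * U * (magic * magicᴴ) := by
        rw [magic_mul_conjTranspose_self, Matrix.one_mul, Matrix.mul_one]
    _ = magic * (magicᴴ * U * magic) * magicᴴ := by simp only [Matrix.mul_assoc]
    _ = (magic * magicᴴ) * localOp A B * (magic * (Matrix.diagonal s *
          (Matrix.diagonal e * Matrix.diagonal t)) * magicᴴ) * localOp C D * (magic * magicᴴ) := by
        rw [hWe, hOs, hPt]
        simp only [Matrix.mul_assoc]
    _ = _ := by
        rw [hdiag, magic_mul_conjTranspose_self, Matrix.one_mul, Matrix.mul_one, uGlobal_eq_magic,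
          Matrix.mul_smul, Matrix.smul_mul, Matrix.mul_smul, Matrix.smul_mul]

/-! ### The three-qubit circuit -/

/-- The operator preserves the parity of the two bits. Y⊗Y equals -X⊗X on equal bits and X⊗X on
unequal ones, so the blocks involve x - y and x + y respectively. -/
theorem uGlobal_mulVec (x y z : ℝ) (ξ : Fin 2 → Fin 2 → ℂ) (a b : Fin 2) :
    (uGlobal x y z *ᵥ fun w => ξ (w 0) (w 1)) ![a, b] =
      if a = b then
        Complex.exp (Complex.I * z) *
          ((Complex.exp (Complex.I * (x - y)) + Complex.exp (-Complex.I * (x - y))) / 2 * ξ a b +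
          (Complex.exp (Complex.I * (x - y)) - Complex.exp (-Complex.I * (x - y))) / 2 *
            ξ (a + 1) (b + 1))
      else
        Complex.exp (-Complex.I * z) *
          ((Complex.exp (Complex.I * (x + y)) + Complex.exp (-Complex.I * (x + y))) / 2 * ξ a b +
          (Complex.exp (Complex.I * (x + y)) - Complex.exp (-Complex.I * (x + y))) / 2 *
            ξ (a + 1) (b + 1)) := by
  have h := inv_sqrt_two_mul_self
  have hs : star ((1 / √2 : ℝ) : ℂ) = ((1 / √2 : ℝ) : ℂ) := Complex.conj_ofReal _
  have hI := Complex.I_mul_I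
  have h₀ : Complex.exp (Complex.I * (x - y + z)) =
      Complex.exp (Complex.I * z) * Complex.exp (Complex.I * (x - y)) := by
    rw [← Complex.exp_add]; ring_nf
  have h₁ : Complex.exp (Complex.I * (-x + y + z)) =
      Complex.exp (Complex.I * z) * Complex.exp (-Complex.I * (x - y)) := by
    rw [← Complex.exp_add]; ring_nf
  have h₂ : Complex.exp (Complex.I * (x + y - z)) =
      Complex.exp (-Complex.I * z) * Complex.exp (Complex.I * (x + y)) := by
    rw [← Complex.exp_add]; ring_nf
  have h₃ : Complex.exp (Complex.I * (-x - y - z)) =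
      Complex.exp (-Complex.I * z) * Complex.exp (-Complex.I * (x + y)) := by
    rw [← Complex.exp_add]; ring_nf
  rw [uGlobal_eq_magic, ← Matrix.mulVec_mulVec, ← Matrix.mulVec_mulVec]
  simp only [Matrix.mulVec, dotProduct, sum_bits, Fin.sum_univ_four, Matrix.diagonal_apply,
    Matrix.conjTranspose_apply, magic, Matrix.of_apply, quatMatrix, magicPhase, star_mul', hs]
  simp only [Matrix.cons_val_zero, Matrix.cons_val_one, Matrix.cons_val, h₀, h₁, h₂, h₃]
  generalize ((1 / √2 : ℝ) : ℂ) = r at h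
  generalize Complex.exp (Complex.I * z) = e₁
  generalize Complex.exp (-Complex.I * z) = e₂
  generalize Complex.exp (Complex.I * (x - y)) = e₃
  generalize Complex.exp (-Complex.I * (x - y)) = e₄
  generalize Complex.exp (Complex.I * (x + y)) = e₅
  generalize Complex.exp (-Complex.I * (x + y)) = e₆
  clear h₀ h₁ h₂ h₃
  fin_cases a <;> fin_cases b <;> simp
  all_goals
    generalize Complex.I = i at *
    generalize ξ 0 0 = ξ₀₀
    generalize ξ 0 1 = ξ₀₁
    generalize ξ 1 0 = ξ₁₀
    generalize ξ 1 1 = ξ₁₁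
    grind

/-- A family of amplitudes for three bits as a vector. -/
def ofBits (F : Fin 2 → Fin 2 → Fin 2 → ℂ) : (Fin 3 → Fin 2) → ℂ := fun x => F (x 0) (x 1) (x 2)

theorem onQubit_mulVec {n : ℕ} (q : Fin n) (A : Matrix (Fin 2) (Fin 2) ℂ) (φ : (Fin n → Fin 2) → ℂ)
    (x : Fin n → Fin 2) :
    (onQubit q A *ᵥ φ) x = ∑ b, A (x q) b * φ (Function.update x q b) := by
  have h : onQubit q A = atQubit q A := by
    ext x y
    simp only [onQubit, atQubit, Matrix.of_apply]
    congr
  rw [h, atQubit_mulVec]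

theorem onQubit_zero_mulVec (A : Matrix (Fin 2) (Fin 2) ℂ) (F : Fin 2 → Fin 2 → Fin 2 → ℂ) :
    onQubit 0 A *ᵥ ofBits F = ofBits fun a t b => ∑ a', A a a' * F a' t b := by
  funext x
  simp [onQubit_mulVec, ofBits]

theorem onQubit_one_mulVec (A : Matrix (Fin 2) (Fin 2) ℂ) (F : Fin 2 → Fin 2 → Fin 2 → ℂ) :
    onQubit 1 A *ᵥ ofBits F = ofBits fun a t b => ∑ t', A t t' * F a t' b := by
  funext x
  simp [onQubit_mulVec, ofBits]

theorem onQubit_two_mulVec (A : Matrix (Fin 2) (Fin 2) ℂ) (F : Fin 2 → Fin 2 → Fin 2 → ℂ) :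
    onQubit 2 A *ᵥ ofBits F = ofBits fun a t b => ∑ b', A b b' * F a t b' := by
  funext x
  simp [onQubit_mulVec, ofBits]

theorem sum_three_bits {M : Type} [AddCommMonoid M] (f : (Fin 3 → Fin 2) → M) :
    ∑ x, f x = ∑ a, ∑ t, ∑ b, f ![a, t, b] := by
  rw [← (Fin.consEquiv fun _ : Fin 3 => Fin 2).sum_comp, Fintype.sum_prod_type]
  refine Finset.sum_congr rfl fun a _ => ?_
  rw [sum_bits]
  simp only [Fin.sum_univ_two]
  rfl

theorem fullyControlled_mulVec (u : Fin 2 → Fin 2 → Matrix (Fin 2) (Fin 2) ℂ)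
    (F : Fin 2 → Fin 2 → Fin 2 → ℂ) :
    fullyControlled u *ᵥ ofBits F = ofBits fun a t b => ∑ t', u a b t t' * F a t' b := by
  funext x
  simp only [Matrix.mulVec, dotProduct, fullyControlled, Matrix.of_apply, ofBits, sum_three_bits,
    Matrix.cons_val_zero, Matrix.cons_val_one, Matrix.cons_val]
  generalize x 0 = a; generalize x 1 = t; generalize x 2 = b
  fin_cases a <;> fin_cases b <;> simp [Fin.sum_univ_two]

theorem secondTarget_apply (y z : ℝ) (a b t t' : Fin 2) :
    secondTarget y z a b t t' = if t = t' then secondTarget y z a b t t else 0 := by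
  unfold secondTarget
  split_ifs with h₁ h₂ h₂
  · rw [h₂]
  · fin_cases t <;> fin_cases t' <;> simp at h₂ ⊢
  · rw [h₂]
  · fin_cases t <;> fin_cases t' <;> simp at h₂ ⊢

/-- The amplitudes after the first controlled gate and the Hadamard gate on the second qubit. -/
noncomputable def parityState (ξ : Fin 2 → Fin 2 → ℂ) (a t b : Fin 2) : ℂ :=
  if t = a + b then ∑ a', ∑ b', hadamard a a' * hadamard b b' * ξ a' b' else 0

theorem pauliX_apply (a b : Fin 2) : pauliX a b = if b = a + 1 then 1 else 0 := by
  fin_cases a <;> fin_cases b <;> simp [pauliX]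

/-- Fixing the parity `t` in the Hadamard basis projects onto the eigenvalue (-1)^t of X⊗X, that is,
applies (1 + (-1)^t X⊗X)/2. -/
theorem parityState_hadamard (ξ : Fin 2 → Fin 2 → ℂ) (a t b : Fin 2) :
    ∑ b', hadamard b b' * ∑ a', hadamard a a' * parityState ξ a' t b' =
      1 / 2 * (bitSign t 1 * ξ (a + 1) (b + 1) + ξ a b) := by
  have h := inv_sqrt_two_mul_self
  simp only [parityState, hadamard_apply]
  generalize ((1 / √2 : ℝ) : ℂ) = r at h
  fin_cases a <;> fin_cases t <;> fin_cases b <;> simp [Fin.sum_univ_two, bitSign] <;>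
  · generalize ξ 0 0 = ξ₀₀
    generalize ξ 0 1 = ξ₀₁
    generalize ξ 1 0 = ξ₁₀
    generalize ξ 1 1 = ξ₁₁
    grind

/-- The label `t` marks the eigenvalue (-1)^t of X⊗X, and equality of the two control bits marks
that of Z⊗Z; together they fix Y⊗Y. The two diagonal gates multiply to the matching phase of
`uGlobal`. For t = 1 their factors -i give -1, cancelling the sign from the gates X on both qubits.
The last Hadamard contributes (-1)^(mt)/√2, the action of (X⊗X)^m up to scale, which the shift by
`m` removes. -/
theorem outcome_amplitude (x y z : ℝ) (ξ : Fin 2 → Fin 2 → ℂ) (m a b : Fin 2) :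
    ∑ t, lastGate x m t * (secondTarget y z (a + m) (b + m) t t *
      (1 / 2 * (bitSign t 1 * ξ (a + m) (b + m) + ξ (a + m + 1) (b + m + 1)))) =
      ((1 / √2 : ℝ) : ℂ) * (uGlobal x y z *ᵥ fun w => ξ (w 0) (w 1)) ![a, b] := by
  have hI := Complex.I_mul_I
  have e₁ : Complex.exp (Complex.I * x) * Complex.exp (Complex.I * (z - y)) =
      Complex.exp (Complex.I * z) * Complex.exp (Complex.I * (x - y)) := by
    rw [← Complex.exp_add, ← Complex.exp_add]; ring_nf
  have e₂ : Complex.exp (-Complex.I * x) * Complex.exp (Complex.I * (z + y)) =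
      Complex.exp (Complex.I * z) * Complex.exp (-Complex.I * (x - y)) := by
    rw [← Complex.exp_add, ← Complex.exp_add]; ring_nf
  have e₃ : Complex.exp (Complex.I * x) * Complex.exp (-Complex.I * (z - y)) =
      Complex.exp (-Complex.I * z) * Complex.exp (Complex.I * (x + y)) := by
    rw [← Complex.exp_add, ← Complex.exp_add]; ring_nf
  have e₄ : Complex.exp (-Complex.I * x) * Complex.exp (-Complex.I * (z + y)) =
      Complex.exp (-Complex.I * z) * Complex.exp (-Complex.I * (x + y)) := by
    rw [← Complex.exp_add, ← Complex.exp_add]; ring_nf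
  rw [uGlobal_mulVec]
  simp only [lastGate, Matrix.mul_apply, Fin.sum_univ_two, hadamard_apply, add_left_inj, secondTarget]
  split_ifs <;>
  · simp only [Matrix.of_apply, Matrix.cons_val_zero, Matrix.cons_val_one]
    generalize ((1 / √2 : ℝ) : ℂ) = r
    generalize Complex.exp (Complex.I * z) = f₁ at *
    generalize Complex.exp (-Complex.I * z) = f₂ at *
    generalize Complex.exp (Complex.I * (x - y)) = f₃ at *
    generalize Complex.exp (-Complex.I * (x - y)) = f₄ at *
    generalize Complex.exp (Complex.I * (x + y)) = f₅ at *
    generalize Complex.exp (-Complex.I * (x + y)) = f₆ at *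
    generalize Complex.exp (Complex.I * x) = g₁ at *
    generalize Complex.exp (-Complex.I * x) = g₂ at *
    generalize Complex.exp (Complex.I * (z - y)) = g₃ at *
    generalize Complex.exp (-Complex.I * (z - y)) = g₄ at *
    generalize Complex.exp (Complex.I * (z + y)) = g₅ at *
    generalize Complex.exp (-Complex.I * (z + y)) = g₆ at *
    generalize Complex.I = i at *
    fin_cases m
    · simp [bitSign]
      generalize ξ a b = ξ₀
      generalize ξ (a + 1) (b + 1) = ξ₁
      grind
    · have h₂ : ∀ c : Fin 2, c + 1 + 1 = c := by decide
      simp [bitSign, h₂]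
      generalize ξ a b = ξ₀
      generalize ξ (a + 1) (b + 1) = ξ₁
      grind

/-- This is H Z^b H = X^b: a sign controlled by `b` between Hadamard gates adds `b` to the target
bit. -/
theorem hadamard_bitSign_hadamard (a b t : Fin 2) :
    ∑ t', hadamard t t' * (bitSign b t' * hadamard t' a) = if t = a + b then 1 else 0 := by
  have h := inv_sqrt_two_mul_self
  simp only [hadamard_apply]
  generalize ((1 / √2 : ℝ) : ℂ) = r at h
  fin_cases a <;> fin_cases b <;> fin_cases t <;> simp [Fin.sum_univ_two, bitSign] <;>
    linear_combination 2 * h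

theorem firstTarget_apply (a b t t' : Fin 2) :
    firstTarget a b t t' = if t = t' then bitSign (a + b) t else 0 := by
  fin_cases a <;> fin_cases b <;> fin_cases t <;> fin_cases t' <;>
    simp [firstTarget, bitSign, pauliZ]

theorem braSecond_conjTranspose_mulVec (ξ : Fin 2 → Fin 2 → ℂ) :
    (braSecond 0)ᴴ *ᵥ (fun w => ξ (w 0) (w 1)) = ofBits fun a t b => if t = 0 then ξ a b else 0 := by
  funext x
  simp only [Matrix.mulVec, dotProduct, Matrix.conjTranspose_apply, braSecond, Matrix.of_apply,
    sum_bits, ofBits]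
  generalize x 0 = a; generalize x 1 = t; generalize x 2 = b
  fin_cases a <;> fin_cases t <;> fin_cases b <;> simp

theorem braSecond_mulVec (m : Fin 2) (F : Fin 2 → Fin 2 → Fin 2 → ℂ) :
    braSecond m *ᵥ ofBits F = fun w => F (w 0) m (w 1) := by
  funext w
  simp only [Matrix.mulVec, dotProduct, braSecond, Matrix.of_apply, sum_three_bits, ofBits,
    Matrix.cons_val_zero, Matrix.cons_val_one, Matrix.cons_val]
  generalize w 0 = a; generalize w 1 = b
  fin_cases a <;> fin_cases m <;> fin_cases b <;> simp [Fin.sum_univ_two]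

theorem outcomeOp_mulVec (m : Fin 2) (F : Fin 2 → Fin 2 → Fin 2 → ℂ) :
    outcomeOp m *ᵥ ofBits F = fun w => F (w 0 + m) m (w 1 + m) := by
  have h : outcomeOp m = (if m = 1 then onQubit 0 pauliX * onQubit 1 pauliX else 1 :
    Matrix (Fin 2 → Fin 2) (Fin 2 → Fin 2) ℂ) * braSecond m := rfl
  rw [h, ← Matrix.mulVec_mulVec, braSecond_mulVec]
  fin_cases m
  · simp
  · simp only [Fin.mk_one, if_true, onQubit_mul_onQubit]
    funext w
    simp only [Matrix.mulVec, dotProduct, localOp, Matrix.of_apply, sum_bits, pauliX_apply,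
      Matrix.cons_val_zero, Matrix.cons_val_one]
    generalize w 0 = a; generalize w 1 = b
    fin_cases a <;> fin_cases b <;> simp

theorem circuit_mulVec (x y z : ℝ) (ξ : Fin 2 → Fin 2 → ℂ) :
    circuit x y z *ᵥ ((braSecond 0)ᴴ *ᵥ fun w => ξ (w 0) (w 1)) = ofBits fun a m b =>
      ∑ t, lastGate x m t * (secondTarget y z a b t t *
        (1 / 2 * (bitSign t 1 * ξ a b + ξ (a + 1) (b + 1)))) := by
  have h₂ : ∀ c : Fin 2, c + 1 + 1 = c := by decide
  have hfirst : onQubit 0 hadamard *ᵥ (onQubit 1 hadamard *ᵥ (onQubit 2 hadamard *ᵥ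
      (fullyControlled firstTarget *ᵥ (onQubit 0 hadamard *ᵥ (onQubit 1 hadamard *ᵥ
        (onQubit 2 hadamard *ᵥ ((braSecond 0)ᴴ *ᵥ fun w => ξ (w 0) (w 1)))))))) =
      ofBits fun a t b => 1 / 2 * (bitSign t 1 * ξ (a + 1) (b + 1) + ξ a b) := by
    rw [braSecond_conjTranspose_mulVec, onQubit_two_mulVec, onQubit_one_mulVec, onQubit_zero_mulVec,
      fullyControlled_mulVec, onQubit_two_mulVec, onQubit_one_mulVec, onQubit_zero_mulVec]
    congr 1
    funext a t b
    rw [← parityState_hadamard]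
    have hpar : ∀ a t b, parityState ξ a t b =
        (∑ t', hadamard t t' * (bitSign (a + b) t' * hadamard t' 0)) *
          ∑ a', ∑ b', hadamard a a' * hadamard b b' * ξ a' b' := by
      intro a t b
      rw [hadamard_bitSign_hadamard, zero_add, parityState, ite_mul, one_mul, zero_mul]
    simp only [hpar, firstTarget_apply, ite_mul, zero_mul, Finset.sum_ite_eq, Finset.mem_univ,
      if_true, mul_ite, mul_zero, Fin.sum_univ_two, Fin.isValue, one_ne_zero,
      if_false, add_zero]
    ring
  rw [circuit]
  simp only [← Matrix.mulVec_mulVec]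
  rw [hfirst, onQubit_two_mulVec, onQubit_zero_mulVec, fullyControlled_mulVec, onQubit_one_mulVec]
  congr 1
  funext a m b
  refine Finset.sum_congr rfl fun t _ => ?_
  have h := secondTarget_apply y z a b t
  generalize secondTarget y z a b t t = d at h ⊢
  simp only [h, pauliX_apply, ite_mul, one_mul, zero_mul,
    Finset.sum_ite_eq, Finset.sum_ite_eq', Finset.mem_univ, if_true, h₂]

/-- The Kraus operator is the same for both outcomes, so each occurs with weight 1/2 and the
measurement reveals nothing about the input. -/
theorem outcomeOp_mul_circuit (x y z : ℝ) (m : Fin 2) :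
    outcomeOp m * circuit x y z * (braSecond 0)ᴴ = ((1 / √2 : ℝ) : ℂ) • uGlobal x y z := by
  have h : ∀ ξ : Fin 2 → Fin 2 → ℂ,
      (outcomeOp m * circuit x y z * (braSecond 0)ᴴ) *ᵥ (fun w => ξ (w 0) (w 1)) =
        (((1 / √2 : ℝ) : ℂ) • uGlobal x y z) *ᵥ fun w => ξ (w 0) (w 1) := by
    intro ξ
    rw [← Matrix.mulVec_mulVec, ← Matrix.mulVec_mulVec, circuit_mulVec, outcomeOp_mulVec,
      Matrix.smul_mulVec]
    funext w
    rw [outcome_amplitude, ← bits_eq]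
    rfl
  refine Matrix.ext_of_mulVec_single fun v => ?_
  obtain ⟨ξ, hξ⟩ : ∃ ξ : Fin 2 → Fin 2 → ℂ, Pi.single v 1 = fun w => ξ (w 0) (w 1) :=
    ⟨fun a b => (Pi.single v 1 : (Fin 2 → Fin 2) → ℂ) ![a, b],
      funext fun w => congrArg _ (bits_eq w)⟩
  rw [hξ, h]

theorem measureAndCorrect_circuit (x y z : ℝ) (ρ : Matrix (Fin 2 → Fin 2) (Fin 2 → Fin 2) ℂ) :
    measureAndCorrect (circuit x y z * prepareZero ρ * (circuit x y z)ᴴ) =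
      uGlobal x y z * ρ * (uGlobal x y z)ᴴ := by
  have h : ∀ m, outcomeOp m * (circuit x y z * prepareZero ρ * (circuit x y z)ᴴ) * (outcomeOp m)ᴴ =
      (1 / 2 : ℂ) • (uGlobal x y z * ρ * (uGlobal x y z)ᴴ) := by
    intro m
    calc _ = (outcomeOp m * circuit x y z * (braSecond 0)ᴴ) * ρ *
          (outcomeOp m * circuit x y z * (braSecond 0)ᴴ)ᴴ := by
          simp only [prepareZero, Matrix.conjTranspose_mul, Matrix.conjTranspose_conjTranspose,
            Matrix.mul_assoc]
      _ = _ := by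
          rw [outcomeOp_mul_circuit, Matrix.conjTranspose_smul, Matrix.smul_mul, Matrix.smul_mul,
            Matrix.mul_smul, smul_smul, RCLike.star_def, Complex.conj_ofReal, inv_sqrt_two_mul_self]
  rw [measureAndCorrect, Fin.sum_univ_two, h, h, ← add_smul]
  norm_num

/-! ### Protocols with two logical qubits -/

namespace Network

variable {V : Type} [Fintype V] [DecidableEq V] {k : ℕ} {G : Network V k} {L : Type}
  {κ : V → Type} {Ψ : Type} {χ : Ψ → (∀ v, κ v) → ℂ} {E : Finset G.edges} {pos : L → G.Qubit}
  {θ θ' : Ψ → (L → Fin 2) → ℂ}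

theorem reaches_congr (hr : QubitReaches G.loc (state G E pos θ') χ)
    (h : ∀ ψ y, θ ψ y = θ' ψ y) : QubitReaches G.loc (state G E pos θ) χ := by
  obtain rfl : θ = θ' := funext fun ψ => funext fun y => h ψ y
  exact hr

theorem reaches_smul (c : ℂ) (hr : QubitReaches G.loc (state G E pos θ) χ) :
    QubitReaches G.loc (state G E pos fun ψ y => c * θ ψ y) χ := by
  convert hr.smul c using 3 with ψ x
  rw [state, state]
  ring

omit [Fintype V] [DecidableEq V] in
theorem Admissible.comp_some {pos : Option L → G.Qubit} (h : Admissible E pos) :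
    Admissible E fun l => pos (some l) :=
  ⟨fun _ _ h' => Option.some_injective _ (h.injective h'), fun l => h.ne (some l)⟩

omit [Fintype V] [DecidableEq V] in
theorem admissible_inl : Admissible Finset.univ (Sum.inl : Fin k → G.Qubit) :=
  ⟨Sum.inl_injective, fun _ _ _ _ => Sum.inl_ne_inr⟩

theorem reaches_localOp {pos : Fin 2 → G.Qubit} {θ : Ψ → (Fin 2 → Fin 2) → ℂ}
    (h : Admissible E pos) {A B : Matrix (Fin 2) (Fin 2) ℂ} (hA : Aᴴ * A = 1) (hB : Bᴴ * B = 1)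
    (hr : QubitReaches G.loc (state G E pos fun ψ => localOp A B *ᵥ θ ψ) χ) :
    QubitReaches G.loc (state G E pos θ) χ := by
  refine reaches_unitary h 1 B hB ?_
  refine reaches_unitary h 0 A hA ?_
  refine reaches_congr hr fun ψ y => ?_
  have hy : ∀ a b, Function.update (Function.update y 0 a) 1 b = ![a, b] := by
    intro a b
    funext i
    fin_cases i <;> simp
  simp only [Matrix.mulVec, dotProduct, localOp, Matrix.of_apply, sum_bits, Fin.sum_univ_two,
    Function.update_of_ne (one_ne_zero : (1 : Fin 2) ≠ 0), hy]
  simp only [Matrix.cons_val_zero, Matrix.cons_val_one]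
  ring

theorem reaches_final {G : Network V 2} {χ : Ψ → (∀ v, NodeBits G.output v) → ℂ}
    {pos : Fin 2 → G.Qubit} {θ : Ψ → (Fin 2 → Fin 2) → ℂ}
    {E : Finset G.edges} (h : Admissible E pos) (hE : E = ∅)
    (hloc : ∀ i, G.loc (pos i) = G.output i) (hχ : ∀ ψ x, χ ψ x = θ ψ (ungroup G.output x)) :
    QubitReaches G.loc (state G E pos θ) χ := by
  subst hE
  obtain rfl : χ = _ := funext fun ψ => funext fun x => hχ ψ x
  exact reaches_output h.injective hloc θ

end Network

open Network

/-- `ofBits` with the second qubit as the additional one. -/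
def ofOptionBits (F : Fin 2 → Fin 2 → Fin 2 → ℂ) : (Option (Fin 2) → Fin 2) → ℂ :=
  fun y => F (y (some 0)) (y none) (y (some 1))

theorem norm_secondTarget (y z : ℝ) (a b t : Fin 2) : ‖secondTarget y z a b t t‖ = 1 := by
  have h : ∀ r : ℝ, ‖Complex.exp (Complex.I * r)‖ = 1 := Complex.norm_exp_I_mul_ofReal
  have h' : ∀ r : ℝ, ‖Complex.exp (-Complex.I * r)‖ = 1 := by
    intro r
    have := h (-r)
    rwa [Complex.ofReal_neg, mul_neg, ← neg_mul] at this
  unfold secondTarget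
  rw [← Complex.ofReal_sub, ← Complex.ofReal_add]
  split_ifs <;> fin_cases t <;> simp [-neg_mul, -Complex.ofReal_sub, -Complex.ofReal_add, h, h']

theorem lastGate_unitary (x : ℝ) : (lastGate x)ᴴ * lastGate x = 1 := by
  have h : ∀ r : ℝ, star (Complex.exp (Complex.I * r)) * Complex.exp (Complex.I * r) = 1 := by
    intro r
    rw [RCLike.star_def, RCLike.conj_mul, Complex.norm_exp_I_mul_ofReal]
    simp
  have h₁ := h x
  have h₂ := h (-x)
  rw [Complex.ofReal_neg, mul_neg, ← neg_mul] at h₂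
  rw [lastGate, Matrix.conjTranspose_mul, Matrix.mul_assoc, ← Matrix.mul_assoc hadamardᴴ,
    conjTranspose_hadamard, hadamard_mul_self, Matrix.one_mul]
  generalize Complex.exp (Complex.I * x) = e at *
  generalize Complex.exp (-Complex.I * x) = f at *
  have hI := Complex.I_mul_I
  rw [RCLike.star_def] at h₁ h₂
  ext i j
  fin_cases i <;> fin_cases j <;> simp [Matrix.mul_apply, Matrix.conjTranspose_apply] <;> grind

/-- The correction `X ^ m`. -/
def flipGate (m : Fin 2) : Matrix (Fin 2) (Fin 2) ℂ :=
  Matrix.of fun a b => if b = a + m then 1 else 0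

theorem flipGate_unitary (m : Fin 2) : (flipGate m)ᴴ * flipGate m = 1 := by
  ext a b
  fin_cases m <;> fin_cases a <;> fin_cases b <;>
    simp [flipGate, Matrix.mul_apply, Matrix.conjTranspose_apply, Fin.sum_univ_two]

theorem localOp_mulVec (A B : Matrix (Fin 2) (Fin 2) ℂ) (v : (Fin 2 → Fin 2) → ℂ)
    (w : Fin 2 → Fin 2) :
    (localOp A B *ᵥ v) w = ∑ a, ∑ b, A (w 0) a * B (w 1) b * v ![a, b] := by
  simp only [Matrix.mulVec, dotProduct, localOp, Matrix.of_apply, sum_bits, Fin.sum_univ_two,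
    Matrix.cons_val_zero, Matrix.cons_val_one]

theorem localOp_flipGate_mulVec (m : Fin 2) (v : (Fin 2 → Fin 2) → ℂ) (w : Fin 2 → Fin 2) :
    (localOp (flipGate m) (flipGate m) *ᵥ v) w = v ![w 0 + m, w 1 + m] := by
  simp only [Matrix.mulVec, dotProduct, localOp, flipGate, Matrix.of_apply, sum_bits,
    Matrix.cons_val_zero, Matrix.cons_val_one]
  generalize w 0 + m = a; generalize w 1 + m = b
  fin_cases a <;> fin_cases b <;> simp

theorem hadamard_unitary : hadamardᴴ * hadamard = 1 := by
  rw [conjTranspose_hadamard, hadamard_mul_self]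

/-! ### The butterfly network -/

-- A distributed form of the circuit with the logical qubit `none` as its ancilla. Each of the seven
-- EPR pairs is consumed once.
open ButterflyNode in
theorem butterfly_reaches {A B C D : Matrix (Fin 2) (Fin 2) ℂ} (hA : Aᴴ * A = 1) (hB : Bᴴ * B = 1)
    (hC : Cᴴ * C = 1) (hD : Dᴴ * D = 1) (x y z : ℝ) :
    QubitReaches butterfly.loc (state butterfly Finset.univ Sum.inl fun ψ => ψ)
      fun ψ w => ((localOp A B * uGlobal x y z * localOp C D) *ᵥ ψ) (ungroup butterfly.output w) := by
  let e₁ : butterfly.edges := ⟨(i₁, n₁), by decide⟩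
  let e₂ : butterfly.edges := ⟨(i₂, n₁), by decide⟩
  let f₁ : butterfly.edges := ⟨(i₁, o₁), by decide⟩
  let f₂ : butterfly.edges := ⟨(i₂, o₂), by decide⟩
  let g : butterfly.edges := ⟨(n₁, n₂), by decide⟩
  let h₁ : butterfly.edges := ⟨(n₂, o₁), by decide⟩
  let h₂ : butterfly.edges := ⟨(n₂, o₂), by decide⟩
  let ξ : ((Fin 2 → Fin 2) → ℂ) → Fin 2 → Fin 2 → ℂ := fun ψ a b => (localOp C D *ᵥ ψ) ![a, b]
  have ad := admissible_inl (G := butterfly)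
  refine reaches_localOp ad hC hD ?_
  refine reaches_localOp ad hadamard_unitary hadamard_unitary ?_
  -- The copy of the first bit at n₁ is kept as the ancilla, which saves preparing |0⟩ and applying
  -- the first control. The second control follows through `e₂` and leaves the parity in the
  -- ancilla.
  refine reaches_copy ad (e := e₁) (by decide) 0 0 rfl ?_
  replace ad := ad.option (e := e₁) (by decide) (0 + 1)
  refine reaches_unitary ad none hadamard hadamard_unitary ?_
  refine reaches_interact ad (e := e₂) (by decide) 0 (some 1) rfl (fun b y => bitSign b (y none))
    (fun b y y' h => by rw [h none rfl]) (fun b y => norm_bitSign _ _) ?_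
  replace ad := ad.erase e₂
  refine reaches_unitary ad none hadamard hadamard_unitary ?_
  refine reaches_congr (θ' := fun ψ => ofOptionBits (parityState (ξ ψ))) ?_ fun ψ w => ?_
  swap
  · change _ = parityState _ _ _ _
    simp only [parityState, Function.update_self, ne_eq, reduceCtorEq,
      not_false_eq_true, Function.update_of_ne]
    simp only [ite_mul, one_mul, zero_mul, mul_ite, mul_zero, Finset.sum_ite_eq',
      Finset.mem_univ, if_true]
    have h := hadamard_bitSign_hadamard (w (some 0)) (w (some 1)) (w none)
    simp only [← mul_assoc] at h ⊢
    rw [← Finset.sum_mul, h, ite_mul, zero_mul, one_mul]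
    rw [localOp_mulVec]
  -- The data qubits go directly to their outputs, and the ancilla goes through the central edge to
  -- n₂.
  refine reaches_teleport ad (e := f₁) (by decide) 0 (some 0) rfl ?_
  replace ad := ad.update (e := f₁) (by decide) (some 0) (0 + 1)
  refine reaches_teleport ad (e := f₂) (by decide) 0 (some 1) rfl ?_
  replace ad := ad.update (e := f₂) (by decide) (some 1) (0 + 1)
  refine reaches_teleport ad (e := g) (by decide) 0 none rfl ?_
  replace ad := ad.update (e := g) (by decide) none (0 + 1)
  refine reaches_unitary ad (some 0) hadamard hadamard_unitary ?_
  refine reaches_unitary ad (some 1) hadamard hadamard_unitary ?_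
  refine reaches_unitary ad (some 0) (flipGate 1) (flipGate_unitary 1) ?_
  refine reaches_unitary ad (some 1) (flipGate 1) (flipGate_unitary 1) ?_
  refine reaches_congr (θ' := fun ψ => ofOptionBits fun a t b =>
    1 / 2 * (bitSign t 1 * ξ ψ a b + ξ ψ (a + 1) (b + 1))) ?_ fun ψ w => ?_
  swap
  · have h : ∀ a : Fin 2, a + 1 + 1 = a := by decide
    have key := parityState_hadamard (ξ ψ) (w (some 0) + 1) (w none) (w (some 1) + 1)
    rw [h, h] at key
    change _ = 1 / 2 * (_ + _)
    rw [← key]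
    simp only [flipGate, Matrix.of_apply, ofOptionBits, Function.update_self, ne_eq, reduceCtorEq,
      not_false_eq_true, Function.update_of_ne, Option.some.injEq, zero_ne_one, one_ne_zero,
      ite_mul, one_mul, zero_mul, Finset.sum_ite_eq', Finset.mem_univ, if_true]
  -- Both edges at n₂ are used from their output ends (half 1), so that the control bits are copied
  -- to the ancilla at n₂.
  refine reaches_interact₂ ad (e := h₁) (e' := h₂) (by decide) (by decide) (by decide) 1 1
    (some 0) (some 1) rfl rfl rfl (fun a b w => secondTarget y z a b (w none) (w none))
    (fun a b w w' h => by rw [h none rfl]) (fun a b w => norm_secondTarget _ _ _ _ _) ?_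
  replace ad := (ad.erase h₁).erase h₂
  refine reaches_unitary ad none (lastGate x) (lastGate_unitary x) ?_
  refine reaches_measure ad fun m => ?_
  replace ad := ad.comp_some
  -- The outcome at n₂ is announced to the output nodes, which undo (X⊗X)^m.
  refine reaches_localOp ad (flipGate_unitary m) (flipGate_unitary m) ?_
  refine reaches_localOp ad hA hB ?_
  refine reaches_congr (reaches_smul ((1 / √2 : ℝ) : ℂ) (reaches_final (θ := fun ψ =>
    (localOp A B * uGlobal x y z * localOp C D) *ᵥ ψ) ad (by decide)
    (fun i => by fin_cases i <;> rfl) fun ψ w => rfl)) fun ψ w => ?_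
  rw [← Matrix.mulVec_mulVec, ← Matrix.mulVec_mulVec, ← smul_eq_mul, ← Pi.smul_apply,
    ← Matrix.mulVec_smul]
  congr 2
  funext w
  have key := outcome_amplitude x y z (ξ ψ) m (w 0) (w 1)
  rw [localOp_flipGate_mulVec, Pi.smul_apply, smul_eq_mul]
  have hξ : (fun w => ξ ψ (w 0) (w 1)) = localOp C D *ᵥ ψ := funext fun w => by rw [bits_eq w]; rfl
  rw [hξ, ← bits_eq w] at key
  refine Eq.trans (Finset.sum_congr rfl fun t _ => ?_) key
  simp only [ofOptionBits, Function.update_self, ne_eq, reduceCtorEq, not_false_eq_true,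
    Function.update_of_ne, Option.elim_none, Option.elim_some, Matrix.cons_val_zero,
    Matrix.cons_val_one]

/-! ### The grail network -/

/-- The eigenvalues of `exp (i θ Z⊗Z)`. -/
noncomputable def zzPhase (θ : ℝ) (a b : Fin 2) : ℂ :=
  Complex.exp (if a = b then Complex.I * θ else -Complex.I * θ)

theorem norm_zzPhase (θ : ℝ) (a b : Fin 2) : ‖zzPhase θ a b‖ = 1 := by
  unfold zzPhase
  split_ifs
  · exact Complex.norm_exp_I_mul_ofReal θ
  · simpa using Complex.norm_exp_I_mul_ofReal (-θ)

/-- A unitary operator with `yBasis * Z * yBasisᴴ = Y`. -/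
noncomputable def yBasis : Matrix (Fin 2) (Fin 2) ℂ := !![1, 0; 0, Complex.I] * hadamard

theorem conjTranspose_yBasis_mul : yBasisᴴ * yBasis = 1 := by
  have h : !![1, 0; 0, Complex.I]ᴴ * !![1, 0; 0, Complex.I] = 1 := by
    ext i j
    fin_cases i <;> fin_cases j <;> simp [Matrix.mul_apply, Matrix.conjTranspose_apply]
  rw [yBasis, Matrix.conjTranspose_mul, Matrix.mul_assoc, ← Matrix.mul_assoc _ _ hadamard, h,
    Matrix.one_mul, hadamard_unitary]

theorem yBasis_mul_conjTranspose : yBasis * yBasisᴴ = 1 :=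
  mul_eq_one_comm.1 conjTranspose_yBasis_mul

theorem hadamard_zzPhase_hadamard (θ : ℝ) (v : (Fin 2 → Fin 2) → ℂ) (w : Fin 2 → Fin 2) :
    (localOp hadamard hadamard *ᵥ fun u =>
      zzPhase θ (u 0) (u 1) * (localOp hadamard hadamard *ᵥ v) u) w =
      (Complex.exp (Complex.I * θ) + Complex.exp (-Complex.I * θ)) / 2 * v w +
      (Complex.exp (Complex.I * θ) - Complex.exp (-Complex.I * θ)) / 2 *
        v ![w 0 + 1, w 1 + 1] := by
  have h := inv_sqrt_two_mul_self
  rw [bits_eq w]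
  simp only [localOp_mulVec, Fin.sum_univ_two, hadamard_apply, zzPhase, Matrix.cons_val_zero,
    Matrix.cons_val_one]
  generalize ((1 / √2 : ℝ) : ℂ) = r at h
  generalize w 0 = a
  generalize w 1 = b
  fin_cases a <;> fin_cases b <;> simp [bitSign, -neg_mul] <;> grind

/-- Conjugation by `yBasis` turns Z⊗Z into Y⊗Y, which flips both bits with the sign -1 on equal bits
and +1 on unequal ones. -/
theorem yBasis_zzPhase_yBasis (θ : ℝ) (v : (Fin 2 → Fin 2) → ℂ) (w : Fin 2 → Fin 2) :
    (localOp yBasis yBasis *ᵥ fun u =>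
      zzPhase θ (u 0) (u 1) * (localOp yBasisᴴ yBasisᴴ *ᵥ v) u) w =
      (Complex.exp (Complex.I * θ) + Complex.exp (-Complex.I * θ)) / 2 * v w -
      (if w 0 = w 1 then 1 else -1) *
        ((Complex.exp (Complex.I * θ) - Complex.exp (-Complex.I * θ)) / 2 *
          v ![w 0 + 1, w 1 + 1]) := by
  rw [yBasis, Matrix.conjTranspose_mul, conjTranspose_hadamard, ← localOp_mul, ← localOp_mul]
  simp only [← Matrix.mulVec_mulVec]
  rw [localOp_mulVec]
  simp only [hadamard_zzPhase_hadamard]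
  simp only [localOp_mulVec]
  rw [bits_eq w]
  have hI := Complex.I_mul_I
  simp only [Fin.sum_univ_two, Matrix.cons_val_zero, Matrix.cons_val_one]
  generalize w 0 = a
  generalize w 1 = b
  generalize (Complex.exp (Complex.I * θ) + Complex.exp (-Complex.I * θ)) / 2 = c
  generalize (Complex.exp (Complex.I * θ) - Complex.exp (-Complex.I * θ)) / 2 = s
  fin_cases a <;> fin_cases b <;> simp [Matrix.conjTranspose_apply] <;> grind

/-- The exponential is a product of three commuting factors, each a Z⊗Z phase between one-qubit
basis changes; this is the form that single EPR pairs can realise. -/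
theorem uGlobal_mulVec_eq (x y z : ℝ) (v : (Fin 2 → Fin 2) → ℂ) (w : Fin 2 → Fin 2) :
    (uGlobal x y z *ᵥ v) w = zzPhase z (w 0) (w 1) *
      (localOp yBasis yBasis *ᵥ fun u => zzPhase y (u 0) (u 1) *
        (localOp yBasisᴴ yBasisᴴ *ᵥ localOp hadamard hadamard *ᵥ fun u =>
          zzPhase x (u 0) (u 1) * (localOp hadamard hadamard *ᵥ v) u) u) w := by
  simp only [yBasis_zzPhase_yBasis, hadamard_zzPhase_hadamard]
  have key := uGlobal_mulVec x y z (fun a b => v ![a, b]) (w 0) (w 1)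
  have hv : (fun u : Fin 2 → Fin 2 => v ![u 0, u 1]) = v := funext fun u => by rw [← bits_eq]
  rw [hv, ← bits_eq] at key
  rw [key]
  have e₁ : Complex.exp (Complex.I * (x - y)) =
      Complex.exp (Complex.I * x) * Complex.exp (-Complex.I * y) := by
    rw [← Complex.exp_add]; ring_nf
  have e₂ : Complex.exp (-Complex.I * (x - y)) =
      Complex.exp (-Complex.I * x) * Complex.exp (Complex.I * y) := by
    rw [← Complex.exp_add]; ring_nf
  have e₃ : Complex.exp (Complex.I * (x + y)) =
      Complex.exp (Complex.I * x) * Complex.exp (Complex.I * y) := by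
    rw [← Complex.exp_add]; ring_nf
  have e₄ : Complex.exp (-Complex.I * (x + y)) =
      Complex.exp (-Complex.I * x) * Complex.exp (-Complex.I * y) := by
    rw [← Complex.exp_add]; ring_nf
  have h : ∀ a : Fin 2, a + 1 + 1 = a := by decide
  rw [e₁, e₂, e₃, e₄, zzPhase]
  simp only [Matrix.cons_val_zero, Matrix.cons_val_one, h, ← bits_eq w]
  split_ifs <;> ring

-- Qubit 0 moves along `p₁`, `p₂`, `p₃` and qubit 1 along `q₁`, `q₂`, `q₃`. The moves are
-- interleaved so that the qubits sit at the two ends of `r₁`, `r₂` and `r₃` in turn, once for each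
-- factor.
open Network GrailNode in
theorem grail_reaches {A B C D : Matrix (Fin 2) (Fin 2) ℂ} (hA : Aᴴ * A = 1) (hB : Bᴴ * B = 1)
    (hC : Cᴴ * C = 1) (hD : Dᴴ * D = 1) (x y z : ℝ) :
    QubitReaches grail.loc (state grail Finset.univ Sum.inl fun ψ => ψ)
      fun ψ w => ((localOp A B * uGlobal x y z * localOp C D) *ᵥ ψ) (ungroup grail.output w) := by
  let p₁ : grail.edges := ⟨(i₁, n₁), by decide⟩
  let p₂ : grail.edges := ⟨(n₁, n₂), by decide⟩
  let p₃ : grail.edges := ⟨(n₂, o₁), by decide⟩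
  let q₁ : grail.edges := ⟨(i₂, n₃), by decide⟩
  let q₂ : grail.edges := ⟨(n₃, n₄), by decide⟩
  let q₃ : grail.edges := ⟨(n₄, o₂), by decide⟩
  let r₁ : grail.edges := ⟨(i₂, n₁), by decide⟩
  let r₂ : grail.edges := ⟨(n₂, n₃), by decide⟩
  let r₃ : grail.edges := ⟨(n₄, o₁), by decide⟩
  have ad := admissible_inl (G := grail)
  refine reaches_localOp ad hC hD ?_
  refine reaches_localOp ad hadamard_unitary hadamard_unitary ?_
  refine reaches_teleport ad (e := p₁) (by decide) 0 0 rfl ?_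
  replace ad := ad.update (e := p₁) (by decide) 0 (0 + 1)
  refine reaches_interact ad (e := r₁) (by decide) 0 1 rfl (fun a w => zzPhase x (w 0) a)
    (fun a w w' h => by rw [h 0 rfl]) (fun a w => norm_zzPhase _ _ _) ?_
  replace ad := ad.erase r₁
  refine reaches_localOp ad hadamard_unitary hadamard_unitary ?_
  refine reaches_localOp ad (A := yBasisᴴ) (B := yBasisᴴ)
    (by rw [Matrix.conjTranspose_conjTranspose, yBasis_mul_conjTranspose])
    (by rw [Matrix.conjTranspose_conjTranspose, yBasis_mul_conjTranspose]) ?_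
  refine reaches_teleport ad (e := p₂) (by decide) 0 0 rfl ?_
  replace ad := ad.update (e := p₂) (by decide) 0 (0 + 1)
  refine reaches_teleport ad (e := q₁) (by decide) 0 1 rfl ?_
  replace ad := ad.update (e := q₁) (by decide) 1 (0 + 1)
  -- Here the bit of qubit 0 is copied to the node of qubit 1; for `r₁` and `r₃` it is the other way
  -- round.
  refine reaches_interact ad (e := r₂) (by decide) 0 0 rfl (fun a w => zzPhase y a (w 1))
    (fun a w w' h => by rw [h 1 rfl]) (fun a w => norm_zzPhase _ _ _) ?_
  replace ad := ad.erase r₂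
  refine reaches_localOp ad conjTranspose_yBasis_mul conjTranspose_yBasis_mul ?_
  refine reaches_teleport ad (e := p₃) (by decide) 0 0 rfl ?_
  replace ad := ad.update (e := p₃) (by decide) 0 (0 + 1)
  refine reaches_teleport ad (e := q₂) (by decide) 0 1 rfl ?_
  replace ad := ad.update (e := q₂) (by decide) 1 (0 + 1)
  refine reaches_interact ad (e := r₃) (by decide) 0 1 rfl (fun a w => zzPhase z (w 0) a)
    (fun a w w' h => by rw [h 0 rfl]) (fun a w => norm_zzPhase _ _ _) ?_
  replace ad := ad.erase r₃
  refine reaches_localOp ad hA hB ?_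
  refine reaches_teleport ad (e := q₃) (by decide) 0 1 rfl ?_
  replace ad := ad.update (e := q₃) (by decide) 1 (0 + 1)
  refine reaches_final ad (by decide) (fun i => by fin_cases i <;> rfl) fun ψ w => ?_
  rw [← Matrix.mulVec_mulVec, ← Matrix.mulVec_mulVec]
  congr 2
  exact funext fun u => uGlobal_mulVec_eq x y z _ u

/-! ### Two-qubit unitaries -/

theorem Reaches.smul_target {V : Type} [Fintype V] [DecidableEq V] {ι κ : V → Type} {Ψ : Type}
    {φ : Ψ → (∀ v, ι v) → ℂ} {χ : Ψ → (∀ v, κ v) → ℂ} (h : Reaches φ χ) {c : ℂ} (hc : c ≠ 0) :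
    Reaches φ fun ψ => c • χ ψ := by
  obtain ⟨Γ, hΓ, r, hr⟩ := h
  refine ⟨Γ, hΓ, r * (c * star c)⁻¹, fun ψ => ?_⟩
  rw [proj_smul, smul_smul, inv_mul_cancel_right₀ (mul_ne_zero hc (star_ne_zero.2 hc)), hr]

/-- The scalar `g` of the decomposition only rescales the target projector, so it is enough that it
is nonzero, which unitarity of the whole forces. -/
theorem Network.implements_of_cartan {V : Type} [Fintype V] [DecidableEq V] {G : Network V 2}
    (h : ∀ {A B C D : Matrix (Fin 2) (Fin 2) ℂ}, Aᴴ * A = 1 → Bᴴ * B = 1 → Cᴴ * C = 1 →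
      Dᴴ * D = 1 → ∀ x y z : ℝ, QubitReaches G.loc (state G Finset.univ Sum.inl fun ψ => ψ)
        fun ψ w => ((localOp A B * uGlobal x y z * localOp C D) *ᵥ ψ) (ungroup G.output w))
    {U : Matrix (Fin 2 → Fin 2) (Fin 2 → Fin 2) ℂ}
    (hU : U ∈ Matrix.unitaryGroup (Fin 2 → Fin 2) ℂ) : G.Implements U := by
  obtain ⟨A, hA, B, hB, C, hC, D, hD, g, x, y, z, rfl⟩ := exists_cartan_decomposition hU
  have hg : g ≠ 0 := by
    rintro rfl
    rw [zero_smul, Matrix.mem_unitaryGroup_iff, zero_mul] at hU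
    exact zero_ne_one hU
  refine G.implements_of_reaches hU ?_
  rw [Matrix.mem_unitaryGroup_iff'] at hA hB hC hD
  unfold QubitReaches
  convert Reaches.smul_target (h hA hB hC hD x y z) hg using 3 with ψ w
  rw [Matrix.smul_mulVec]
  rfl

/-- The butterfly network as a grid of three rows and two columns. -/
def butterflyEquiv : ButterflyNode ≃ Fin 3 × Fin 2 where
  toFun
    | .i₁ => (0, 0) | .n₁ => (1, 0) | .i₂ => (2, 0)
    | .o₁ => (0, 1) | .n₂ => (1, 1) | .o₂ => (2, 1)
  invFun p := ![![.i₁, .o₁], ![.n₁, .n₂], ![.i₂, .o₂]] p.1 p.2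
  left_inv v := by cases v <;> rfl
  right_inv := by decide

theorem butterfly_adj_iff (u v : ButterflyNode) :
    butterfly.Adj u v ↔ (cluster 3 2).Adj (butterflyEquiv u) (butterflyEquiv v) := by
  unfold Network.Adj
  revert u v
  decide

end QNet

theorem mainTheorem3 :
    -- every two-qubit unitary is deterministically implementable over the butterfly network
    (∀ U ∈ Matrix.unitaryGroup (Fin 2 → Fin 2) ℂ, QNet.butterfly.Implements U) ∧
    -- the butterfly network has the topology of the (3,2)-cluster network
    (∃ φ : QNet.ButterflyNode ≃ Fin 3 × Fin 2,
      φ .i₁ = (0, 0) ∧ φ .n₁ = (1, 0) ∧ φ .i₂ = (2, 0) ∧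
      φ .o₁ = (0, 1) ∧ φ .n₂ = (1, 1) ∧ φ .o₂ = (2, 1) ∧
      ∀ u v, QNet.butterfly.Adj u v ↔ (QNet.cluster 3 2).Adj (φ u) (φ v)) ∧
    -- the explicit circuit realises exp(i(xXX + yYY + zZZ))
    (∀ (x y z : ℝ) (ρ : Matrix (Fin 2 → Fin 2) (Fin 2 → Fin 2) ℂ),
      QNet.measureAndCorrect
          (QNet.circuit x y z * QNet.prepareZero ρ * (QNet.circuit x y z)ᴴ) =
        QNet.uGlobal x y z * ρ * (QNet.uGlobal x y z)ᴴ) ∧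
    -- every two-qubit unitary is deterministically implementable over the grail network
    (∀ U ∈ Matrix.unitaryGroup (Fin 2 → Fin 2) ℂ, QNet.grail.Implements U) := by
  refine ⟨fun U hU => QNet.Network.implements_of_cartan QNet.butterfly_reaches hU,
    ⟨QNet.butterflyEquiv, rfl, rfl, rfl, rfl, rfl, rfl, QNet.butterfly_adj_iff⟩,
    QNet.measureAndCorrect_circuit,
    fun U hU => QNet.Network.implements_of_cartan QNet.grail_reaches hU⟩
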